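/- Let $d,n\ge 1$ and let $V=(V_{kl}(z))$, $z\in\mathbb Z^d$, $1\le k,l\le n$, be a real matrix-valued function such that - (E1) there are constants $C,\alpha>0$ with $|V_{kl}(z)|\le Ce^{-\alpha|z|}$ for all $k,l$ and all $z\in\mathbb Z^d$; - (E2) $V_{lk}(-z)=V_{kl}(z)\in\mathbb R$ for all $k,l$ and all $z\in\mathbb Z^d$. Let $\mathbb T^d=\mathbb R^d/2\pi\mathbb Z^d$ and let $\hat V(\theta)=\sum_{z\in\mathbb Z^d}V(z)e^{iz\cdot\theta}$, a Hermitian $n\times n$ matrix for each $\theta\in\mathbb T^d$. Let $\Omega(\theta)=\hat V(\theta)^{1/2}$ be its principal square root: it has the eigenvectors of $\hat V(\theta)$, and an eigenvalue $a$ of $\hat V(\theta)$ is replaced by $\sqrt a$ if $a\ge 0$ and by $i\sqrt{-a}$ if $a<0$. (If $\hat V(\theta)$ is non-negative definite, $\Omega(\theta)$ is its non-negative definite square root.) The eigenvalues $\omega_1(\theta),\dots,\omega_n(\theta)$ of $\Omega(\theta)$, repeated according to multiplicity, are called the dispersion relations; they are real and non-negative wherever $\hat V(\theta)$ is non-negative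 definite. Then there is a closed set $\mathcal C_*\subset\mathbb T^d$, and an enumeration $\omega_1(\theta),\dots,\omega_n(\theta)$ of the dispersion relations for all $\theta\in\mathbb T^d$, such that: (i) the Lebesgue measure of $\mathcal C_*$ is zero. (ii) Every $\Theta\in\mathbb T^d\setminus\mathcal C_*$ has an open neighborhood $\mathcal O(\Theta)$ on which all $\omega_k$ are real-analytic and on which there is a real-analytic function $B$ with values in the unitary $n\times n$ matrices such that $$\Omega(\theta)=B(\theta)\,\mathrm{diag}(\omega_1(\theta),\dots,\omega_n(\theta))\,B(\theta)^*,\qquad \theta\in\mathcal O(\Theta).$$ (iii) The eigenvalues have constant multiplicity off $\mathcal C_*$: there are integers $s\ge 0$ and $0=r_0<r_1<\dots<r_{s+1}=n$ such that, for every $\theta\in\mathbb T^d\setminus\mathcal C_*$, all $1\le\sigma,\nu\le s+1$ and all $k\in(r_{\sigma-1},r_\sigma]$, $l\in(r_{\nu-1},r_\nu]$, one has $\omega_k(\theta)=\omega_l(\theta)$ if and only if $\sigma=\nu$. (iv) For $\theta\in\mathbb T^d\setminus\mathcal C_*$ and $1\le\sigma\le s+1$, let $\Pi_\sigma(\theta)$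 be the orthogonal projection in $\mathbb C^n$ onto the eigenspace of $\Omega(\theta)$ for the eigenvalue $\omega_{r_\sigma}(\theta)$. Each $\Pi_\sigma$ is a real-analytic function on $\mathbb T^d\setminus\mathcal C_*$, and $$\Omega(\theta)=\sum_{\sigma=1}^{s+1}\omega_{r_\sigma}(\theta)\,\Pi_\sigma(\theta),\qquad \theta\in\mathbb T^d\setminus\mathcal C_*.$$ -/

import Mathlib

open scoped ComplexOrder

noncomputable section

namespace Crystal

/-- Makes `AddCircle (2π)` a compact measure space of total mass `2π`. -/
instance factTwoPiPos : Fact (0 < 2 * Real.pi) := ⟨Real.two_pi_pos⟩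

/-- The torus `ℝ^d / 2πℤ^d`, with the product topology and Lebesgue (product Haar) measure. -/
abbrev Torus (d : ℕ) : Type := Fin d → AddCircle (2 * Real.pi)

/-- The quotient map `ℝ^d → ℝ^d / 2πℤ^d`. -/
def Torus.proj {d : ℕ} (x : Fin d → ℝ) : Torus d := fun i => (x i : AddCircle (2 * Real.pi))

/-- Real-analyticity at a point of the torus, in the coordinates given by the covering
`ℝ^d → ℝ^d / 2πℤ^d`. -/
def RealAnalyticAt {d : ℕ} (f : Torus d → ℂ) (θ : Torus d) : Prop :=
  ∀ x : Fin d → ℝ, Torus.proj x = θ → AnalyticAt ℝ (fun y => f (Torus.proj y)) x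

/-- Real-analyticity of a matrix-valued function at a point: all entries are real-analytic. -/
def MatrixAnalyticAt {d n : ℕ} (F : Torus d → Matrix (Fin n) (Fin n) ℂ) (θ : Torus d) : Prop :=
  ∀ k l : Fin n, RealAnalyticAt (fun η => F η k l) θ

/-- The Euclidean length of a lattice vector. -/
def latticeNorm {d : ℕ} (z : Fin d → ℤ) : ℝ := Real.sqrt (∑ i, (z i : ℝ) ^ 2)

/-- Exponential decay of the interaction matrix (condition E1). -/
def ExpDecay {d n : ℕ} (V : (Fin d → ℤ) → Matrix (Fin n) (Fin n) ℝ) : Prop :=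
  ∃ C α : ℝ, 0 < C ∧ 0 < α ∧ ∀ (k l : Fin n) (z : Fin d → ℤ),
    |V z k l| ≤ C * Real.exp (-α * latticeNorm z)

/-- Symmetry of the (real) interaction matrix (condition E2). -/
def SymmetricKernel {d n : ℕ} (V : (Fin d → ℤ) → Matrix (Fin n) (Fin n) ℝ) : Prop :=
  ∀ (k l : Fin n) (z : Fin d → ℤ), V (-z) l k = V z k l

/-- The character `θ ↦ exp (i z·θ)` of the torus. -/
def character {d : ℕ} (z : Fin d → ℤ) (θ : Torus d) : ℂ := ∏ i, fourier (z i) (θ i)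

/-- The Fourier transform `∑ z, V(z) exp (i z·θ)`. -/
def symbol {d n : ℕ} (V : (Fin d → ℤ) → Matrix (Fin n) (Fin n) ℝ) (θ : Torus d) :
    Matrix (Fin n) (Fin n) ℂ :=
  Matrix.of fun k l => ∑' z : Fin d → ℤ, (V z k l : ℂ) * character z θ

/-- The principal square root of a Hermitian matrix: same eigenvectors, and each eigenvalue `a`
is replaced by `√a` if `a ≥ 0` and by `i √(-a)` if `a < 0` (`Real.sqrt` vanishes on negative
numbers). For a non-negative definite matrix the second summand vanishes, and this is the
non-negative definite square root. -/
def principalSqrt {n : ℕ} (A : Matrix (Fin n) (Fin n) ℂ) : Matrix (Fin n) (Fin n) ℂ :=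
  cfc (fun a : ℝ => Real.sqrt a) A + Complex.I • cfc (fun a : ℝ => Real.sqrt (-a)) A

/-- The matrix `Ω(θ)`, the square root of the symbol. -/
def Omega {d n : ℕ} (V : (Fin d → ℤ) → Matrix (Fin n) (Fin n) ℝ) (θ : Torus d) :
    Matrix (Fin n) (Fin n) ℂ :=
  principalSqrt (symbol V θ)

/-- The (zero-based) index `k` lies in the `σ`-th of the consecutive blocks
`{r₀, …, r₁ - 1}, {r₁, …, r₂ - 1}, …`. -/
def InBlock {m n : ℕ} (r : Fin (m + 1) → ℕ) (σ : Fin m) (k : Fin n) : Prop :=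
  r σ.castSucc ≤ (k : ℕ) ∧ (k : ℕ) < r σ.succ

end Crystal

end

/-!
The symbol `A(θ) = ∑ V(z) exp(i z·θ)` is a real-analytic family of Hermitian matrices on the torus:
the exponential decay of `V` makes the double series of the Taylor coefficients converge
(`analyticAt_fourierSeries`). Its eigenvalues are real, and the coefficients of the characteristic
polynomial, hence all symmetric polynomials of the eigenvalues, are analytic in `θ`.

**Constant multiplicities.** Choose `Θ₀` where the number of distinct eigenvalues is maximal and let
`κ` be the partition of the indices by the coincidences at `Θ₀`. The symmetric polynomial
`separator`, the sum over all permutations `τ` of `∏ (λ (τ i) - λ (τ j)) ^ 2` over the pairs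
separated by `κ`, is a sum of squares on real families. So it is nonzero exactly where, after a permutation, the
coincidences are among those of `κ`, and by maximality they are then exactly those of `κ`
(`hasPattern_of_separator`). It is nonzero at `Θ₀`, and the zero set of a nonzero real-analytic
function is closed and null (`volume_zeros_eq_zero`, by induction on the dimension and Fubini). The
square root is not analytic at `0`; so the zeros of the determinant are removed too, unless the
determinant vanishes identically, in which case the eigenvalue `0` is locally constant off the
zero set of the separator (`exists_generic_pattern`).

**Analytic eigenvalues.** Where the number of distinct eigenvalues is constant, each of them is
continuous, multiplicities are locally constant by semicontinuity, and an eigenvalue of multiplicity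
`k + 1` is a simple root of the `k`-th derivative of the characteristic polynomial. The implicit
function theorem makes it analytic (`anAt_nodes`). The enumeration sorts the distinct eigenvalues by
size and then applies a permutation that depends on their multiplicities only and makes these agree
with the sizes of the blocks (`levels`). Real eigenvalues can be sorted, so there is no monodromy.

**Projections and frames.** The spectral projections are Lagrange polynomials in `A(θ)`, hence
analytic (`specProj_eq_list_prod`). Applied to an eigenbasis at `Θ` and followed by the Gram–Schmidt
process, which respects the orthogonal eigenspaces, they give the analytic unitary matrix `B`
(`exists_analytic_frame`). The square root `Ω(θ)` is an injective function of `A(θ)`, so it has the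
same eigenspaces.
-/

namespace Crystal

open scoped NNReal ENNReal ContDiff Topology
open MeasureTheory

/-! ### Real-analyticity of the symbol -/

/-- A sum of power series is a power series, provided the double series of norms converges at the
radius considered. -/
theorem hasFPowerSeriesOnBall_tsum {ι E F : Type*} [NormedAddCommGroup E] [NormedSpace ℝ E]
    [NormedAddCommGroup F] [NormedSpace ℝ F] [CompleteSpace F] {f : ι → E → F}
    {p : ι → FormalMultilinearSeries ℝ E F} {x : E} {r : ℝ≥0} (hr : 0 < r)
    (hs : Summable fun q : ι × ℕ => ‖p q.1 q.2‖ * (r : ℝ) ^ q.2)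
    (hf : ∀ i y, ‖y‖ < r → HasSum (fun k => p i k fun _ => y) (f i (x + y))) :
    HasFPowerSeriesOnBall (fun y => ∑' i, f i y) (fun k => ∑' i, p i k) x r := by
  have hr' : (0 : ℝ) < r := hr
  have hs2 : Summable fun q : ℕ × ι => ‖p q.2 q.1‖ * (r : ℝ) ^ q.1 :=
    (Equiv.prodComm ℕ ι).summable_iff.mpr hs
  have hpk : ∀ k, Summable fun i => ‖p i k‖ := fun k => by
    have := (hs2.prod_factor k).mul_right (((r : ℝ) ^ k)⁻¹)
    refine this.congr fun i => ?_
    field_simp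
  refine ⟨?_, by exact_mod_cast hr, ?_⟩
  · refine FormalMultilinearSeries.le_radius_of_summable_norm _ ?_
    refine Summable.of_nonneg_of_le (fun k => by positivity) (fun k => ?_) hs2.prod
    calc ‖∑' i, p i k‖ * (r : ℝ) ^ k ≤ (∑' i, ‖p i k‖) * (r : ℝ) ^ k := by
          gcongr
          exact norm_tsum_le_tsum_norm (hpk k)
      _ = ∑' i, ‖p i k‖ * (r : ℝ) ^ k := tsum_mul_right.symm
  · intro y hy
    have hy' : ‖y‖ < r := by simpa [enorm] using hy
    have hle : ∀ i k, ‖p i k fun _ => y‖ ≤ ‖p i k‖ * (r : ℝ) ^ k := fun i k => by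
      refine ((p i k).le_opNorm _).trans ?_
      simp only [Finset.prod_const, Finset.card_univ, Fintype.card_fin]
      gcongr
    have hsum : Summable fun q : ℕ × ι => p q.2 q.1 fun _ => y :=
      Summable.of_norm_bounded hs2 fun q => hle q.2 q.1
    have hsum' : Summable fun q : ι × ℕ => p q.1 q.2 fun _ => y :=
      Summable.of_norm_bounded hs fun q => hle q.1 q.2
    have h1 : HasSum (fun k => ∑' i, p i k fun _ => y) (∑' q : ℕ × ι, p q.2 q.1 fun _ => y) :=
      hsum.hasSum.prod_fiberwise fun k => (hsum.prod_factor k).hasSum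
    have h2 : ∑' q : ℕ × ι, p q.2 q.1 (fun _ => y) = ∑' i, f i (x + y) := by
      have := (Equiv.prodComm ℕ ι).tsum_eq fun q : ι × ℕ => p q.1 q.2 fun _ => y
      rw [show (∑' q : ℕ × ι, p q.2 q.1 fun _ => y) = ∑' q : ι × ℕ, p q.1 q.2 fun _ => y from this]
      rw [hsum'.tsum_prod]
      exact tsum_congr fun i => (hf i y hy').tsum_eq
    rw [h2] at h1
    convert h1 using 2 with k
    exact (ContinuousMultilinearMap.apply ℝ (fun _ : Fin k => E) F fun _ => y).map_tsum
      (Summable.of_norm (hpk k))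

theorem summable_pi_prod {f : ℤ → ℝ} (h0 : ∀ z, 0 ≤ f z) (hf : Summable f) :
    ∀ d : ℕ, Summable fun z : Fin d → ℤ => ∏ i, f (z i)
  | 0 => Summable.of_finite
  | d + 1 => by
    rw [← (Fin.consEquiv fun _ : Fin (d + 1) => ℤ).summable_iff]
    refine (hf.mul_of_nonneg (summable_pi_prod h0 hf d) h0
      fun z => Finset.prod_nonneg fun i _ => h0 _).congr fun q => ?_
    simp [Fin.prod_univ_succ]

theorem summable_exp_neg_abs {b : ℝ} (hb : 0 < b) :
    Summable fun z : ℤ => Real.exp (-b * |(z : ℝ)|) := by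
  have h : Summable fun k : ℕ => Real.exp (-b * k) := by
    have := summable_geometric_of_lt_one (Real.exp_pos (-b)).le (by simpa using hb)
    refine this.congr fun k => ?_
    rw [← Real.exp_nat_mul]; ring_nf
  refine Summable.of_nat_of_neg (h.congr fun k => by simp) (h.congr fun k => by simp)

theorem abs_le_latticeNorm {d : ℕ} (z : Fin d → ℤ) (i : Fin d) :
    |(z i : ℝ)| ≤ latticeNorm z := by
  rw [← Real.sqrt_sq_eq_abs]
  exact Real.sqrt_le_sqrt (Finset.single_le_sum (f := fun i => (z i : ℝ) ^ 2)
    (fun i _ => sq_nonneg _) (Finset.mem_univ i))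

/-- The linear form `y ↦ i z·y`. -/
noncomputable def phase {d : ℕ} (z : Fin d → ℤ) : (Fin d → ℝ) →L[ℝ] ℂ :=
  ∑ i, (ContinuousLinearMap.proj (R := ℝ) (φ := fun _ : Fin d => ℝ) i).smulRight
    (Complex.I * (z i : ℂ))

theorem phase_apply {d : ℕ} (z : Fin d → ℤ) (y : Fin d → ℝ) :
    phase z y = ∑ i, (y i : ℂ) * (Complex.I * z i) := by
  simp [phase]

theorem norm_phase_le {d : ℕ} (z : Fin d → ℤ) : ‖phase z‖ ≤ ∑ i, |(z i : ℝ)| := by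
  refine ContinuousLinearMap.opNorm_le_bound _ (by positivity) fun y => ?_
  rw [phase_apply, Finset.sum_mul]
  refine (norm_sum_le _ _).trans (Finset.sum_le_sum fun i _ => ?_)
  have h1 : ‖(z i : ℂ)‖ = |(z i : ℝ)| := by
    rw [← Complex.ofReal_intCast, Complex.norm_real, Real.norm_eq_abs]
  have h2 : ‖(y i : ℂ)‖ ≤ ‖y‖ := by
    rw [Complex.norm_real]; exact norm_le_pi_norm y i
  rw [norm_mul, norm_mul, Complex.norm_I, one_mul, h1, mul_comm]
  gcongr

theorem character_proj {d : ℕ} (z : Fin d → ℤ) (x : Fin d → ℝ) :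
    character z (Torus.proj x) = Complex.exp (phase z x) := by
  rw [phase_apply, Complex.exp_sum, character]
  refine Finset.prod_congr rfl fun i _ => ?_
  rw [Torus.proj, fourier_coe_apply]
  congr 1
  have : (Real.pi : ℂ) ≠ 0 := by exact_mod_cast Real.pi_ne_zero
  push_cast
  field_simp

/-- The power series of `y ↦ c * exp (i z·y)` at the point where the exponential is factored out. -/
noncomputable def phaseSeries {d : ℕ} (c : ℂ) (z : Fin d → ℤ) :
    FormalMultilinearSeries ℝ (Fin d → ℝ) ℂ :=
  fun k => c • (NormedSpace.expSeries ℝ ℂ).compContinuousLinearMap (phase z) k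

theorem norm_phaseSeries_le {d : ℕ} (c : ℂ) (z : Fin d → ℤ) (k : ℕ) :
    ‖phaseSeries c z k‖ ≤ ‖c‖ * ((k.factorial : ℝ)⁻¹ * (∑ i, |(z i : ℝ)|) ^ k) := by
  have h3 : ‖NormedSpace.expSeries ℝ ℂ k‖ ≤ (k.factorial : ℝ)⁻¹ := by
    rw [NormedSpace.expSeries, norm_smul]
    simp
  rw [phaseSeries, norm_smul]
  refine mul_le_mul_of_nonneg_left ?_ (norm_nonneg _)
  refine (FormalMultilinearSeries.norm_compContinuousLinearMap_le _ _ _).trans ?_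
  exact mul_le_mul h3 (pow_le_pow_left₀ (norm_nonneg _) (norm_phase_le z) k) (by positivity)
    (by positivity)

theorem hasSum_phaseSeries {d : ℕ} (c : ℂ) (z : Fin d → ℤ) (y : Fin d → ℝ) :
    HasSum (fun k => phaseSeries c z k fun _ => y) (c * Complex.exp (phase z y)) := by
  have h := (NormedSpace.expSeries_div_hasSum_exp (phase z y)).mul_left c
  rw [← Complex.exp_eq_exp_ℂ] at h
  have e : ∀ k, phaseSeries c z k (fun _ => y) = c * (phase z y ^ k / k.factorial) := fun k => by
    rw [← NormedSpace.expSeries_apply_eq_div (𝕂 := ℝ)]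
    rfl
  simpa only [e] using h

theorem summable_mul_pow_div_factorial {ι : Type*} {b t : ι → ℝ} (hb : ∀ i, 0 ≤ b i)
    (ht : ∀ i, 0 ≤ t i) (h : Summable fun i => b i * Real.exp (t i)) :
    Summable fun q : ι × ℕ => b q.1 * (t q.1 ^ q.2 / q.2.factorial) := by
  have hexp : ∀ i, HasSum (fun k : ℕ => b i * (t i ^ k / k.factorial)) (b i * Real.exp (t i)) :=
    fun i => by
      rw [Real.exp_eq_exp_ℝ]
      exact (NormedSpace.expSeries_div_hasSum_exp (t i)).mul_left _
  have h0 : ∀ q : ι × ℕ, 0 ≤ b q.1 * (t q.1 ^ q.2 / q.2.factorial) := fun q =>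
    mul_nonneg (hb _) (div_nonneg (pow_nonneg (ht _) _) (Nat.cast_nonneg _))
  refine (summable_prod_of_nonneg h0).mpr ⟨fun i => (hexp i).summable, ?_⟩
  exact h.congr fun i => (hexp i).tsum_eq.symm

theorem analyticAt_fourierSeries {d : ℕ} {a : (Fin d → ℤ) → ℂ} {C α : ℝ} (hC : 0 < C) (hα : 0 < α)
    (ha : ∀ z, ‖a z‖ ≤ C * Real.exp (-α * latticeNorm z)) (x : Fin d → ℝ) :
    AnalyticAt ℝ (fun y : Fin d → ℝ => ∑' z, a z * character z (Torus.proj y)) x := by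
  -- since `∑ |zᵢ| ≤ d |z|`, the coefficients decay like `exp (-2 r ∑ |zᵢ|)`, and the exponential
  -- series of `i z·y` converges for `‖y‖ < r` with a loss of at most `exp (r ∑ |zᵢ|)`
  set S : (Fin d → ℤ) → ℝ := fun z => ∑ i, |(z i : ℝ)| with hS
  have hS0 : ∀ z, 0 ≤ S z := fun z => Finset.sum_nonneg fun i _ => abs_nonneg _
  obtain ⟨r, hr0, hr⟩ : ∃ r : ℝ, 0 < r ∧ 2 * r * (d + 1) = α :=
    ⟨α / (2 * (d + 1)), by positivity, by field_simp⟩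
  have hSr : ∀ z, 2 * r * S z ≤ α * latticeNorm z := fun z => by
    have h1 : S z ≤ d * latticeNorm z := by
      refine (Finset.sum_le_sum fun i _ => abs_le_latticeNorm z i).trans ?_
      simp
    have h0 : 0 ≤ latticeNorm z := Real.sqrt_nonneg _
    calc 2 * r * S z ≤ 2 * r * (d * latticeNorm z) := by gcongr
      _ ≤ 2 * r * ((d + 1) * latticeNorm z) := by gcongr; linarith
      _ = α * latticeNorm z := by rw [← mul_assoc, hr]
  have hcoef : ∀ z, ‖a z * Complex.exp (phase z x)‖ ≤ C * Real.exp (-(2 * r * S z)) := fun z => by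
    have : ‖Complex.exp (phase z x)‖ = 1 := by
      rw [Complex.norm_exp, phase_apply]; simp
    rw [norm_mul, this, mul_one]
    refine (ha z).trans ?_
    gcongr
    linarith [hSr z]
  have hp : ∀ z k, ‖phaseSeries (a z * Complex.exp (phase z x)) z k‖ * r ^ k ≤
      C * Real.exp (-(2 * r * S z)) * ((r * S z) ^ k / k.factorial) := fun z k => by
    have := hS0 z
    calc ‖phaseSeries (a z * Complex.exp (phase z x)) z k‖ * r ^ k
        ≤ (C * Real.exp (-(2 * r * S z)) * ((k.factorial : ℝ)⁻¹ * S z ^ k)) * r ^ k := by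
          refine mul_le_mul_of_nonneg_right ((norm_phaseSeries_le _ z k).trans ?_) (by positivity)
          exact mul_le_mul_of_nonneg_right (hcoef z) (by positivity)
      _ = _ := by rw [mul_pow]; ring
  have hmaj : Summable fun q : (Fin d → ℤ) × ℕ =>
      C * Real.exp (-(2 * r * S q.1)) * ((r * S q.1) ^ q.2 / q.2.factorial) := by
    refine summable_mul_pow_div_factorial (b := fun z => C * Real.exp (-(2 * r * S z)))
      (t := fun z => r * S z) (fun z => by positivity) (fun z => mul_nonneg hr0.le (hS0 z)) ?_
    refine ((summable_pi_prod (fun _ => (Real.exp_pos _).le)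
      (summable_exp_neg_abs hr0) d).mul_left C).congr fun z => ?_
    rw [mul_assoc, ← Real.exp_add, ← Real.exp_sum, ← Finset.mul_sum]
    congr 2
    simp only [hS]; ring
  have hs : Summable fun q : (Fin d → ℤ) × ℕ =>
      ‖phaseSeries (a q.1 * Complex.exp (phase q.1 x)) q.1 q.2‖ * r ^ q.2 :=
    Summable.of_nonneg_of_le (fun q => mul_nonneg (norm_nonneg _) (pow_nonneg hr0.le _))
      (fun q => hp q.1 q.2) hmaj
  lift r to ℝ≥0 using hr0.le
  have key := hasFPowerSeriesOnBall_tsum (x := x) (r := r)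
    (f := fun z y => a z * character z (Torus.proj y))
    (p := fun z => phaseSeries (a z * Complex.exp (phase z x)) z)
    hr0 hs fun z y _ => ?_
  · exact key.analyticAt
  · have h := hasSum_phaseSeries (a z * Complex.exp (phase z x)) z y
    rwa [mul_assoc, ← Complex.exp_add, ← map_add, ← character_proj z (x + y)] at h

/-! ### Real-analyticity on the torus -/

theorem isOpenQuotientMap_proj {d : ℕ} : IsOpenQuotientMap (Torus.proj (d := d)) :=
  IsOpenQuotientMap.piMap fun _ => QuotientAddGroup.isOpenQuotientMap_mk

theorem exists_proj_eq {d : ℕ} (θ : Torus d) : ∃ x, Torus.proj x = θ :=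
  isOpenQuotientMap_proj.surjective θ

/-- Real-analyticity at a point of the torus for functions with values in an arbitrary real normed
space, phrased as `C^ω`-smoothness of all lifts. -/
def AnAt {d : ℕ} {E : Type*} [NormedAddCommGroup E] [NormedSpace ℝ E] (f : Torus d → E)
    (θ : Torus d) : Prop :=
  ∀ x : Fin d → ℝ, Torus.proj x = θ → ContDiffAt ℝ ω (fun y => f (Torus.proj y)) x

section AnAt

variable {d : ℕ} {E F : Type*} [NormedAddCommGroup E] [NormedSpace ℝ E]
  [NormedAddCommGroup F] [NormedSpace ℝ F] {θ : Torus d}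

theorem anAt_iff_realAnalyticAt {f : Torus d → ℂ} : AnAt f θ ↔ RealAnalyticAt f θ :=
  forall₂_congr fun _ _ => ⟨fun h => h.analyticAt, fun h => h.contDiffAt⟩

theorem AnAt.continuousAt {f : Torus d → E} (hf : AnAt f θ) : ContinuousAt f θ := by
  obtain ⟨x, rfl⟩ := exists_proj_eq θ
  exact isOpenQuotientMap_proj.continuousAt_comp_iff.mp (hf x rfl).continuousAt

theorem AnAt.congr {f g : Torus d → E} (hf : AnAt f θ) (h : ∀ᶠ η in 𝓝 θ, g η = f η) :
    AnAt g θ := fun x hx => by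
  subst hx
  exact (hf x rfl).congr_of_eventuallyEq
    (isOpenQuotientMap_proj.continuous.continuousAt.eventually h)

theorem AnAt.comp {g : E → F} {f : Torus d → E} (hg : ContDiffAt ℝ ω g (f θ)) (hf : AnAt f θ) :
    AnAt (fun η => g (f η)) θ := fun x hx => by
  subst hx
  exact ContDiffAt.comp x hg (hf x rfl)

theorem anAt_const (c : E) : AnAt (fun _ : Torus d => c) θ := fun _ _ => contDiffAt_const

theorem AnAt.add {f g : Torus d → E} (hf : AnAt f θ) (hg : AnAt g θ) :
    AnAt (fun η => f η + g η) θ := fun x hx => (hf x hx).add (hg x hx)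

theorem AnAt.sub {f g : Torus d → E} (hf : AnAt f θ) (hg : AnAt g θ) :
    AnAt (fun η => f η - g η) θ := fun x hx => (hf x hx).sub (hg x hx)

theorem AnAt.sum {ι : Type*} {f : ι → Torus d → E} {s : Finset ι} (hf : ∀ i ∈ s, AnAt (f i) θ) :
    AnAt (fun η => ∑ i ∈ s, f i η) θ := fun x hx => ContDiffAt.sum fun i hi => hf i hi x hx

theorem AnAt.mul {A : Type*} [NormedRing A] [NormedAlgebra ℝ A] {f g : Torus d → A}
    (hf : AnAt f θ) (hg : AnAt g θ) : AnAt (fun η => f η * g η) θ :=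
  fun x hx => (hf x hx).mul (hg x hx)

theorem AnAt.smul {f : Torus d → ℂ} {g : Torus d → E} [NormedSpace ℂ E] [IsScalarTower ℝ ℂ E]
    (hf : AnAt f θ) (hg : AnAt g θ) : AnAt (fun η => f η • g η) θ :=
  fun x hx => (hf x hx).smul (hg x hx)

theorem AnAt.inner {E : Type*} [NormedAddCommGroup E] [InnerProductSpace ℂ E] [NormedSpace ℝ E]
    [IsScalarTower ℝ ℂ E] {f g : Torus d → E} (hf : AnAt f θ) (hg : AnAt g θ) :
    AnAt (fun η => inner ℂ (f η) (g η)) θ := fun x hx => (hf x hx).inner ℂ (hg x hx)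

theorem AnAt.ofReal {f : Torus d → ℝ} (hf : AnAt f θ) : AnAt (fun η => (f η : ℂ)) θ :=
  AnAt.comp Complex.ofRealCLM.contDiff.contDiffAt hf

theorem AnAt.re {f : Torus d → ℂ} (hf : AnAt f θ) : AnAt (fun η => (f η).re) θ :=
  AnAt.comp Complex.reCLM.contDiff.contDiffAt hf

theorem AnAt.inv {f : Torus d → ℂ} (hf : AnAt f θ) (h0 : f θ ≠ 0) :
    AnAt (fun η => (f η)⁻¹) θ := fun x hx => (hf x hx).inv (by simpa [hx] using h0)

theorem AnAt.sqrt {f : Torus d → ℝ} (hf : AnAt f θ) (h0 : f θ ≠ 0) :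
    AnAt (fun η => Real.sqrt (f η)) θ := AnAt.comp (Real.contDiffAt_sqrt h0) hf

theorem AnAt.mvPolynomial_eval₂ {σ R A : Type*} [CommSemiring R] [NormedCommRing A]
    [NormedAlgebra ℝ A] (φ : R →+* A) {f : σ → Torus d → A} (hf : ∀ i, AnAt (f i) θ)
    (p : MvPolynomial σ R) :
    AnAt (fun η => p.eval₂ φ fun i => f i η) θ := by
  induction p using MvPolynomial.induction_on with
  | C a => simpa using anAt_const (d := d) (φ a)
  | add p q hp hq => simpa using hp.add hq
  | mul_X p i hp => simpa using hp.mul (hf i)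

end AnAt

/-! ### Zero sets of real-analytic functions -/

theorem countable_zeros_of_analyticOnNhd {f : ℝ → ℝ} (hf : AnalyticOnNhd ℝ f Set.univ)
    (h0 : ∃ t, f t ≠ 0) : {t | f t = 0}.Countable := by
  have hU : ∀ t, insert t {u | f u ≠ 0} ∈ 𝓝 t := fun t => by
    rw [insert_mem_nhds_iff]
    by_contra h
    have hfr : ∃ᶠ u in 𝓝[≠] t, f u = 0 := fun h' => h h'
    obtain ⟨u, hu⟩ := h0
    exact hu (hf.eqOn_zero_of_preconnected_of_frequently_eq_zero isPreconnected_univ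
      (Set.mem_univ t) hfr (Set.mem_univ u))
  obtain ⟨s, hs, hcov⟩ := TopologicalSpace.countable_cover_nhds hU
  refine hs.mono fun t (ht : f t = 0) => ?_
  obtain ⟨u, hu, htu⟩ := Set.mem_iUnion₂.mp (hcov.symm ▸ Set.mem_univ t)
  rcases htu with rfl | h
  · exact hu
  · exact absurd ht h

theorem volume_zeros_of_analyticOnNhd : ∀ {d : ℕ} {f : (Fin d → ℝ) → ℝ},
    AnalyticOnNhd ℝ f Set.univ → (∃ x, f x ≠ 0) → volume {x | f x = 0} = 0
  | 0, f, _, ⟨x, hx⟩ => by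
    convert measure_empty (μ := (volume : Measure (Fin 0 → ℝ)))
    ext y
    simpa [Subsingleton.elim y x] using hx
  | d + 1, f, hf, ⟨x, hx⟩ => by
    let e := MeasurableEquiv.piFinSuccAbove (fun _ : Fin (d + 1) => ℝ) 0
    have he := volume_preserving_piFinSuccAbove (fun _ : Fin (d + 1) => ℝ) 0
    have hclosed : IsClosed {x | f x = 0} :=
      isClosed_eq (continuousOn_univ.mp hf.continuousOn) continuous_const
    let g : ℝ × (Fin d → ℝ) → (Fin (d + 1) → ℝ) := fun q => Fin.cons q.1 q.2
    have hg : ∀ q, e.symm q = g q := fun q => by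
      simp [e, g, MeasurableEquiv.piFinSuccAbove, Fin.consEquiv]
    have hgan : ∀ q, AnalyticAt ℝ g q := fun q => by
      refine AnalyticAt.pi fun i => ?_
      refine Fin.cases ?_ (fun i => ?_) i
      · exact analyticAt_fst
      · exact ((ContinuousLinearMap.proj (R := ℝ) (φ := fun _ : Fin d => ℝ) i).analyticAt _).comp
          analyticAt_snd
    have hfg : ∀ q, AnalyticAt ℝ (fun q => f (g q)) q := fun q =>
      (hf (g q) trivial).comp (hgan q)
    have hmeas : MeasurableSet {q : ℝ × (Fin d → ℝ) | f (g q) = 0} :=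
      (isClosed_eq (continuous_iff_continuousAt.mpr fun q => (hfg q).continuousAt)
        continuous_const).measurableSet
    have h1 : volume {x | f x = 0} = volume {q : ℝ × (Fin d → ℝ) | f (g q) = 0} := by
      rw [← he.symm.measure_preimage hclosed.measurableSet.nullMeasurableSet]
      congr 1
      ext q
      exact iff_of_eq (congrArg (fun z => f z = 0) (hg q))
    rw [h1, Measure.volume_eq_prod, Measure.measure_prod_null hmeas]
    -- the slice over `t` is null unless `f` vanishes identically on it, and this happens for
    -- countably many `t` only, as a nonzero function of one variable shows
    have hx' : f (g (x 0, Fin.tail x)) ≠ 0 := by simpa [g] using hx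
    have hcount : {t | f (g (t, Fin.tail x)) = 0}.Countable :=
      countable_zeros_of_analyticOnNhd (fun t _ =>
        AnalyticAt.comp (g := fun q => f (g q)) (f := fun t : ℝ => (t, Fin.tail x)) (hfg _)
          (analyticAt_id.prod analyticAt_const)) ⟨x 0, hx'⟩
    have hae : ∀ᵐ t : ℝ, f (g (t, Fin.tail x)) ≠ 0 := by
      simpa [ae_iff] using hcount.measure_zero volume
    filter_upwards [hae] with t ht
    exact volume_zeros_of_analyticOnNhd (fun y _ =>
        AnalyticAt.comp (g := fun q => f (g q)) (f := fun y : Fin d → ℝ => (t, y)) (hfg _)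
          (analyticAt_const.prod analyticAt_id)) ⟨_, ht⟩

theorem isClosed_zeros {d : ℕ} {f : Torus d → ℝ} (hf : ∀ θ, AnAt f θ) :
    IsClosed {θ | f θ = 0} :=
  isClosed_eq (continuous_iff_continuousAt.mpr fun θ => (hf θ).continuousAt) continuous_const

/-- The zero set of a real-analytic function on the torus is null unless the function vanishes
identically. -/
theorem volume_zeros_eq_zero {d : ℕ} {f : Torus d → ℝ} (hf : ∀ θ, AnAt f θ)
    (h0 : ∃ θ, f θ ≠ 0) : volume {θ | f θ = 0} = 0 := by
  have hmp : MeasurePreserving (Torus.proj (d := d))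
      (Measure.pi fun _ => volume.restrict (Set.Ioc 0 (0 + 2 * Real.pi))) volume :=
    measurePreserving_pi _ _ fun _ => AddCircle.measurePreserving_mk (2 * Real.pi) 0
  rw [← hmp.measure_preimage (isClosed_zeros hf).measurableSet.nullMeasurableSet,
    ← Measure.restrict_pi_pi]
  refine Measure.restrict_apply_eq_zero' ?_ |>.mpr ?_
  · exact MeasurableSet.univ_pi fun _ => measurableSet_Ioc
  · refine measure_mono_null Set.inter_subset_left ?_
    obtain ⟨θ, hθ⟩ := h0
    obtain ⟨x, rfl⟩ := exists_proj_eq θ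
    exact volume_zeros_of_analyticOnNhd
      (fun y _ => (hf _ y rfl).analyticAt) ⟨x, hθ⟩

/-! ### Coincidence patterns of finite families of reals -/

section Patterns

variable {n m : ℕ}

/-- The number of indices at which a family takes the value `t`. -/
noncomputable def mult (a : Fin n → ℝ) (t : ℝ) : ℕ := (Finset.univ.filter fun i => a i = t).card

/-- A family of reals has the pattern of the colouring `κ` if, after a permutation of the indices,
its coincidences are exactly those of `κ`. -/
def HasPattern (κ : Fin n → Fin m) (a : Fin n → ℝ) : Prop :=
  ∃ v : Fin m → ℝ, Function.Injective v ∧ ∃ τ : Equiv.Perm (Fin n), ∀ i, a (τ i) = v (κ i)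

/-- The sum over all permutations `τ` of `∏ (X (τ i) - X (τ j)) ^ 2`, taken over the pairs which `κ`
separates. On real families it vanishes unless the coincidences are, up to a permutation, among
those of `κ`. -/
noncomputable def separator (κ : Fin n → Fin m) : MvPolynomial (Fin n) ℝ :=
  ∑ τ : Equiv.Perm (Fin n), ∏ q ∈ Finset.univ.filter fun q : Fin n × Fin n => κ q.1 ≠ κ q.2,
    (MvPolynomial.X (τ q.1) - MvPolynomial.X (τ q.2)) ^ 2

theorem separator_isSymmetric (κ : Fin n → Fin m) : (separator κ).IsSymmetric := fun e => by
  simp only [separator, map_sum, map_prod, map_pow, map_sub, MvPolynomial.rename_X]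
  exact Equiv.sum_comp (Equiv.mulLeft e) fun τ : Equiv.Perm (Fin n) =>
    ∏ q ∈ Finset.univ.filter fun q : Fin n × Fin n => κ q.1 ≠ κ q.2,
      (MvPolynomial.X (R := ℝ) (τ q.1) - MvPolynomial.X (τ q.2)) ^ 2

theorem eval_separator_ne_zero_iff (κ : Fin n → Fin m) (a : Fin n → ℝ) :
    MvPolynomial.eval a (separator κ) ≠ 0 ↔
      ∃ τ : Equiv.Perm (Fin n), ∀ i j, κ i ≠ κ j → a (τ i) ≠ a (τ j) := by
  simp only [separator, map_sum, map_prod, map_pow, map_sub, MvPolynomial.eval_X]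
  rw [Ne, Finset.sum_eq_zero_iff_of_nonneg fun τ _ => Finset.prod_nonneg fun q _ => sq_nonneg _]
  simp only [Finset.prod_eq_zero_iff, Finset.mem_univ, Finset.mem_filter, true_and,
    forall_const, not_forall, not_exists, Prod.forall, not_and, ne_eq, sq_eq_zero_iff, sub_eq_zero]

/-- A family separated by `κ` that takes at most as many values as `κ` has colours has exactly the
coincidences of `κ`. -/
theorem hasPattern_of_separator {κ : Fin n → Fin m} (hκ : Function.Surjective κ) {a : Fin n → ℝ}
    (hcard : (Finset.univ.image a).card ≤ m) (h : MvPolynomial.eval a (separator κ) ≠ 0) :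
    HasPattern κ a := by
  obtain ⟨τ, hτ⟩ := (eval_separator_ne_zero_iff κ a).mp h
  obtain ⟨s, hs⟩ := hκ.hasRightInverse
  have hv : Function.Injective fun σ => a (τ (s σ)) := fun σ ν h => by
    by_contra hne
    exact hτ (s σ) (s ν) (by simpa only [hs _] using hne) h
  refine ⟨fun σ => a (τ (s σ)), hv, τ, fun i => ?_⟩
  have himg : Finset.univ.image (fun σ => a (τ (s σ))) = Finset.univ.image a := by
    refine Finset.eq_of_subset_of_card_le (fun t ht => ?_) ?_
    · simp only [Finset.mem_image, Finset.mem_univ, true_and] at ht ⊢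
      obtain ⟨σ, rfl⟩ := ht
      exact ⟨_, rfl⟩
    · rwa [Finset.card_image_of_injective _ hv, Finset.card_fin]
  have hi : a (τ i) ∈ Finset.univ.image fun σ => a (τ (s σ)) := by
    rw [himg]; exact Finset.mem_image_of_mem _ (Finset.mem_univ _)
  obtain ⟨σ, -, hσ⟩ := Finset.mem_image.mp hi
  have : κ (s σ) = κ i := by
    by_contra hne
    exact hτ _ _ hne hσ
  rw [hs σ] at this
  rw [← this]
  exact hσ.symm

/-- The distinct values of a family in increasing order, if there are `m` of them. -/
noncomputable def nodes (m : ℕ) (a : Fin n → ℝ) (σ : Fin m) : ℝ :=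
  if h : (Finset.univ.image a).card = m then (Finset.univ.image a).orderEmbOfFin h σ else 0

theorem nodes_strictMono {a : Fin n → ℝ} (h : (Finset.univ.image a).card = m) :
    StrictMono (nodes m a) := fun σ ν hlt => by
  simpa [nodes, h] using hlt

theorem range_nodes {a : Fin n → ℝ} (h : (Finset.univ.image a).card = m) :
    Set.range (nodes m a) = Set.range a := by
  have : nodes m a = (Finset.univ.image a).orderEmbOfFin h := by ext; simp [nodes, h]
  rw [this, Finset.range_orderEmbOfFin]
  simp

theorem nodes_unique {a : Fin n → ℝ} (h : (Finset.univ.image a).card = m) {w : Fin m → ℝ}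
    (hw : StrictMono w) (hmem : ∀ σ, w σ ∈ Set.range a) : w = nodes m a := by
  have h1 : nodes m a = (Finset.univ.image a).orderEmbOfFin h := by ext; simp [nodes, h]
  rw [h1]
  exact Finset.orderEmbOfFin_unique h (fun σ => by simpa using hmem σ) hw

theorem range_eq_of_perm {κ : Fin n → Fin m} (hκ : Function.Surjective κ) {a : Fin n → ℝ}
    {v : Fin m → ℝ} {τ : Equiv.Perm (Fin n)} (hτ : ∀ i, a (τ i) = v (κ i)) :
    Set.range v = Set.range a := by
  rw [← hκ.range_comp, ← τ.surjective.range_comp a]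
  exact congrArg Set.range (funext fun i => (hτ i).symm)

theorem HasPattern.card_image {κ : Fin n → Fin m} (hκ : Function.Surjective κ) {a : Fin n → ℝ}
    (h : HasPattern κ a) : (Finset.univ.image a).card = m := by
  obtain ⟨v, hv, τ, hτ⟩ := h
  have : Finset.univ.image a = Finset.univ.image v := by
    apply Finset.coe_injective
    simp [range_eq_of_perm hκ hτ]
  rw [this, Finset.card_image_of_injective _ hv, Finset.card_fin]

theorem mult_of_perm {κ : Fin n → Fin m} {a : Fin n → ℝ} {v : Fin m → ℝ}
    (hv : Function.Injective v) {τ : Equiv.Perm (Fin n)} (hτ : ∀ i, a (τ i) = v (κ i))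
    (σ : Fin m) : mult a (v σ) = (Finset.univ.filter fun i => κ i = σ).card := by
  symm
  refine Finset.card_equiv τ fun i => ?_
  simp [hτ, hv.eq_iff]

theorem sum_mult_nodes {a : Fin n → ℝ} (h : (Finset.univ.image a).card = m) :
    ∑ σ, mult a (nodes m a σ) = n := by
  have h1 := Finset.card_eq_sum_card_image a Finset.univ
  rw [Finset.card_fin] at h1
  have h2 : Finset.univ.image a = Finset.univ.image (nodes m a) := by
    apply Finset.coe_injective
    simp [range_nodes h]
  rw [h2, Finset.sum_image fun _ _ _ _ h' => (nodes_strictMono h).injective h'] at h1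
  exact h1.symm

open Classical in
/-- A permutation matching the multiplicities `M` to the sizes of the colour classes of `κ`. It
depends on `M` only, so that it is locally constant wherever `M` is. -/
noncomputable def arrange (κ : Fin n → Fin m) (M : Fin m → ℕ) : Equiv.Perm (Fin m) :=
  if h : ∃ π : Equiv.Perm (Fin m), ∀ σ, M (π σ) = (Finset.univ.filter fun i => κ i = σ).card
  then h.choose else 1

/-- The distinct values of a family, enumerated so that the multiplicity of the `σ`-th one is the
size of the `σ`-th colour class of `κ`. -/
noncomputable def levels (κ : Fin n → Fin m) (a : Fin n → ℝ) (σ : Fin m) : ℝ :=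
  nodes m a (arrange κ (fun ν => mult a (nodes m a ν)) σ)

variable {κ : Fin n → Fin m} {a : Fin n → ℝ}

theorem HasPattern.levels_injective (hκ : Function.Surjective κ) (h : HasPattern κ a) :
    Function.Injective (levels κ a) :=
  (nodes_strictMono (h.card_image hκ)).injective.comp (Equiv.injective _)

theorem HasPattern.range_levels (hκ : Function.Surjective κ) (h : HasPattern κ a) :
    Set.range (levels κ a) = Set.range a := by
  rw [← range_nodes (h.card_image hκ)]
  exact (arrange κ fun ν => mult a (nodes m a ν)).surjective.range_comp (nodes m a)

theorem HasPattern.mult_levels (hκ : Function.Surjective κ) (h : HasPattern κ a) (σ : Fin m) :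
    mult a (levels κ a σ) = (Finset.univ.filter fun i => κ i = σ).card := by
  have hex : ∃ π : Equiv.Perm (Fin m), ∀ σ,
      mult a (nodes m a (π σ)) = (Finset.univ.filter fun i => κ i = σ).card := by
    obtain ⟨v, hv, τ, hτ⟩ := id h
    have hinj := (nodes_strictMono (h.card_image hκ)).injective
    have hr : Set.range v = Set.range (nodes m a) := by
      rw [range_nodes (h.card_image hκ), range_eq_of_perm hκ hτ]
    refine ⟨(Equiv.ofInjective v hv).trans ((Equiv.setCongr hr).trans
      (Equiv.ofInjective _ hinj).symm), fun σ => ?_⟩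
    rw [← mult_of_perm hv hτ]
    congr 1
    simp [Equiv.apply_ofInjective_symm]
  have := hex.choose_spec σ
  rwa [levels, arrange, dif_pos hex]

/-- A family with the pattern of `κ` is, up to a permutation, constant on each colour class with
value the corresponding level. -/
theorem HasPattern.exists_perm (hκ : Function.Surjective κ) (h : HasPattern κ a) :
    ∃ τ : Equiv.Perm (Fin n), ∀ i, a (τ i) = levels κ a (κ i) := by
  have hc : ∀ t, Nonempty ({i // levels κ a (κ i) = t} ≃ {i // a i = t}) := fun t => by
    refine ⟨Fintype.equivOfCardEq ?_⟩
    rw [Fintype.card_subtype, Fintype.card_subtype]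
    by_cases ht : t ∈ Set.range (levels κ a)
    · obtain ⟨σ, rfl⟩ := ht
      simp only [(h.levels_injective hκ).eq_iff]
      exact (h.mult_levels hκ σ).symm
    · have ht' : t ∉ Set.range a := by rwa [← h.range_levels hκ]
      rw [Finset.filter_false_of_mem fun i _ hi => ht ⟨_, hi⟩,
        Finset.filter_false_of_mem fun i _ hi => ht' ⟨_, hi⟩]
  exact ⟨Equiv.ofFiberEquiv (f := fun i => levels κ a (κ i)) (g := a) fun t => (hc t).some,
    fun i => Equiv.ofFiberEquiv_map _ i⟩

end Patterns

/-! ### Roots of polynomials with real-analytic coefficients -/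

/-- The monic polynomial with the given roots. -/
noncomputable def rootPoly {n : ℕ} (a : Fin n → ℝ) : Polynomial ℝ :=
  ∏ i, (Polynomial.X - Polynomial.C (a i))

section RootPoly

variable {n m : ℕ} (a : Fin n → ℝ)

theorem rootPoly_ne_zero : rootPoly a ≠ 0 :=
  Finset.prod_ne_zero_iff.mpr fun _ _ => Polynomial.X_sub_C_ne_zero _

theorem natDegree_rootPoly : (rootPoly a).natDegree = n := by
  rw [rootPoly, Polynomial.natDegree_prod_of_monic _ _ fun _ _ => Polynomial.monic_X_sub_C _]
  simp

theorem eval_rootPoly (t : ℝ) : (rootPoly a).eval t = ∏ i, (t - a i) := by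
  simp [rootPoly, Polynomial.eval_prod]

theorem rootMultiplicity_rootPoly (t : ℝ) : (rootPoly a).rootMultiplicity t = mult a t := by
  classical
  rw [← Polynomial.count_roots, rootPoly, Polynomial.roots_prod _ _ (rootPoly_ne_zero a)]
  simp only [Polynomial.roots_X_sub_C, Multiset.bind_singleton]
  rw [Multiset.count_map, mult, Finset.card_def, Finset.filter_val]
  simp only [eq_comm]

/-- The elementary symmetric functions are, up to sign, coefficients of `rootPoly`; hence every
symmetric polynomial of the roots is a polynomial in these coefficients. -/
theorem eval_symmetric {S : MvPolynomial (Fin n) ℝ} (hS : S.IsSymmetric) :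
    ∃ Q : MvPolynomial (Fin n) ℝ, ∀ a : Fin n → ℝ, MvPolynomial.eval a S =
      Q.eval₂ (RingHom.id ℝ) fun i : Fin n =>
        (-1) ^ ((i : ℕ) + 1) * (rootPoly a).coeff (n - (i + 1)) := by
  obtain ⟨Q, hQ⟩ := MvPolynomial.esymmAlgHom_fin_surjective ℝ le_rfl
    (⟨S, hS⟩ : MvPolynomial.symmetricSubalgebra (Fin n) ℝ)
  refine ⟨Q, fun a => ?_⟩
  have h : MvPolynomial.aeval (fun i : Fin n => MvPolynomial.esymm (Fin n) ℝ (i + 1)) Q = S := by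
    rw [← MvPolynomial.esymmAlgHom_apply, hQ]
  have he : ∀ i : Fin n, MvPolynomial.eval a (MvPolynomial.esymm (Fin n) ℝ (i + 1)) =
      (-1) ^ ((i : ℕ) + 1) * (rootPoly a).coeff (n - (i + 1)) := fun i => by
    have hi : (i : ℕ) + 1 ≤ n := i.2
    have hV := Multiset.prod_X_sub_C_coeff (Finset.univ.val.map a) (k := n - (i + 1)) (by simp)
    rw [Multiset.map_map] at hV
    change (rootPoly a).coeff _ = _ at hV
    simp only [Multiset.card_map, Finset.card_val, Finset.card_fin, Nat.sub_sub_self hi] at hV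
    rw [hV, ← mul_assoc, ← pow_add, Even.neg_one_pow ⟨_, rfl⟩, one_mul]
    exact MvPolynomial.aeval_esymm_eq_multiset_esymm (Fin n) ℝ _ a
  rw [← h, MvPolynomial.aeval_def, MvPolynomial.algebraMap_eq, MvPolynomial.hom_eval₂]
  simp only [he]
  congr 1
  ext r
  simp

end RootPoly

section Families

variable {d n m : ℕ} {lam : Torus d → Fin n → ℝ}

theorem anAt_symmetric (hcoef : ∀ k θ, AnAt (fun θ => (rootPoly (lam θ)).coeff k) θ)
    {S : MvPolynomial (Fin n) ℝ} (hS : S.IsSymmetric) (θ : Torus d) :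
    AnAt (fun η => MvPolynomial.eval (lam η) S) θ := by
  obtain ⟨Q, hQ⟩ := eval_symmetric hS
  simp only [hQ]
  exact AnAt.mvPolynomial_eval₂ _ (fun i => (anAt_const _).mul (hcoef _ θ)) Q

/-- Each root at `Θ` is a limit of roots at nearby points. -/
theorem eventually_exists_root_near (hcoef : ∀ k θ, AnAt (fun θ => (rootPoly (lam θ)).coeff k) θ)
    (Θ : Torus d) (i : Fin n) {ε : ℝ} (hε : 0 < ε) :
    ∀ᶠ θ in 𝓝 Θ, ∃ j, |lam θ j - lam Θ i| < ε := by
  have hc : ContinuousAt (fun θ => (rootPoly (lam θ)).eval (lam Θ i)) Θ := by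
    have h : ∀ θ, (rootPoly (lam θ)).eval (lam Θ i) =
        ∑ k ∈ Finset.range (n + 1), (rootPoly (lam θ)).coeff k * lam Θ i ^ k := fun θ =>
      Polynomial.eval_eq_sum_range' (by rw [natDegree_rootPoly]; omega) _
    simp only [h]
    exact (AnAt.sum fun k _ => (hcoef k Θ).mul (anAt_const _)).continuousAt
  have h0 : (rootPoly (lam Θ)).eval (lam Θ i) = 0 := by
    rw [eval_rootPoly]
    exact Finset.prod_eq_zero (Finset.mem_univ i) (sub_self _)
  have hlt : ∀ᶠ θ in 𝓝 Θ, |(rootPoly (lam θ)).eval (lam Θ i)| < ε ^ n := by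
    refine hc.abs.eventually_lt continuousAt_const ?_
    rw [h0, abs_zero]
    positivity
  filter_upwards [hlt] with θ hθ
  by_contra! hge
  refine absurd hθ (not_lt.mpr ?_)
  rw [eval_rootPoly, Finset.abs_prod]
  calc ε ^ n = ∏ _j : Fin n, ε := by simp
    _ ≤ _ := Finset.prod_le_prod (fun _ _ => hε.le) fun j _ => by
      rw [abs_sub_comm]; exact hge j

/-- The distinct roots depend continuously on the parameter where their number is constant. -/
theorem continuousAt_nodes (hcoef : ∀ k θ, AnAt (fun θ => (rootPoly (lam θ)).coeff k) θ)
    {Θ : Torus d} (hΘ : ∀ᶠ θ in 𝓝 Θ, (Finset.univ.image (lam θ)).card = m) (σ : Fin m) :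
    ContinuousAt (fun θ => nodes m (lam θ) σ) Θ := by
  have hcard := hΘ.self_of_nhds
  have hmono := nodes_strictMono hcard
  -- a common lower bound `2 δ` for the gaps between the distinct roots at `Θ`
  obtain ⟨δ, hδ, hgap⟩ : ∃ δ > 0, ∀ σ ν : Fin m, σ < ν →
      nodes m (lam Θ) σ + 2 * δ ≤ nodes m (lam Θ) ν := by
    have : ∀ᶠ δ in 𝓝[>] (0 : ℝ), ∀ σ ν : Fin m, σ < ν →
        nodes m (lam Θ) σ + 2 * δ ≤ nodes m (lam Θ) ν := by
      simp only [Filter.eventually_all]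
      intro σ ν hlt
      have h1 := hmono hlt
      have h2 : (0 : ℝ) < (nodes m (lam Θ) ν - nodes m (lam Θ) σ) / 2 := by linarith
      filter_upwards [Ioo_mem_nhdsGT h2] with δ hδ
      linarith [hδ.2]
    obtain ⟨δ, hδ, hδ0⟩ := (this.and self_mem_nhdsWithin).exists
    exact ⟨δ, hδ0, hδ⟩
  rw [Metric.continuousAt_iff']
  intro ε hε
  have hnear : ∀ᶠ θ in 𝓝 Θ, ∀ ν : Fin m, ∃ j, |lam θ j - nodes m (lam Θ) ν| < min ε δ := by
    rw [Filter.eventually_all]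
    intro ν
    obtain ⟨i, hi⟩ : nodes m (lam Θ) ν ∈ Set.range (lam Θ) := by
      rw [← range_nodes hcard]; exact ⟨ν, rfl⟩
    rw [← hi]
    exact eventually_exists_root_near hcoef Θ i (lt_min hε hδ)
  filter_upwards [hΘ, hnear] with θ hθ hn
  choose j hj using hn
  have hw : (fun ν => lam θ (j ν)) = nodes m (lam θ) := by
    refine nodes_unique hθ (fun σ ν hlt => ?_) fun ν => ⟨_, rfl⟩
    have h1 := (abs_lt.mp ((hj σ).trans_le (min_le_right _ _))).2
    have h2 := (abs_lt.mp ((hj ν).trans_le (min_le_right _ _))).1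
    have h3 := hgap σ ν hlt
    show lam θ (j σ) < lam θ (j ν)
    linarith
  rw [← hw, Real.dist_eq]
  exact (hj σ).trans_le (min_le_left _ _)

theorem contDiffAt_eval_derivative
    (hcoef : ∀ k θ, AnAt (fun θ => (rootPoly (lam θ)).coeff k) θ) (k : ℕ)
    (u : (Fin d → ℝ) × ℝ) :
    ContDiffAt ℝ ω (fun u : (Fin d → ℝ) × ℝ =>
      (Polynomial.derivative^[k] (rootPoly (lam (Torus.proj u.1)))).eval u.2) u := by
  have h : ∀ θ t, (Polynomial.derivative^[k] (rootPoly (lam θ))).eval t =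
      ∑ i ∈ Finset.range (n + 1),
        (((i + k).descFactorial k : ℝ) * (rootPoly (lam θ)).coeff (i + k)) * t ^ i :=
    fun θ t => by
      rw [Polynomial.eval_eq_sum_range' (n := n + 1)]
      · simp [Polynomial.coeff_iterate_derivative]
      · have := Polynomial.natDegree_iterate_derivative (rootPoly (lam θ)) k
        rw [natDegree_rootPoly] at this
        omega
  simp only [h]
  refine ContDiffAt.sum fun i _ => ?_
  refine (contDiffAt_const.mul ?_).mul (contDiffAt_snd.pow i)
  exact ContDiffAt.comp (g := fun x => (rootPoly (lam (Torus.proj x))).coeff (i + k)) u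
    (hcoef _ _ u.1 rfl) contDiffAt_fst

/-- A continuous solution `μ` of `G (x, μ x) = 0`, with `G` analytic, is analytic where the
derivative of `G` in the last variable does not vanish. -/
theorem contDiffAt_of_implicit {E : Type*} [NormedAddCommGroup E] [NormedSpace ℝ E]
    [CompleteSpace E] {G : E × ℝ → ℝ} {μ : E → ℝ} {x₀ : E} (hG : ContDiffAt ℝ ω G (x₀, μ x₀))
    {c : ℝ} (hd : HasDerivAt (fun t => G (x₀, t)) c (μ x₀)) (hc : c ≠ 0)
    (hμ : ContinuousAt μ x₀) (h0 : ∀ᶠ x in 𝓝 x₀, G (x, μ x) = 0) : ContDiffAt ℝ ω μ x₀ := by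
  have hne : (ω : WithTop ℕ∞) ≠ 0 := by simp
  have hinr : fderiv ℝ G (x₀, μ x₀) ∘L .inr ℝ E ℝ = ContinuousLinearMap.toSpanSingleton ℝ c := by
    have h1 : HasFDerivAt (fun t => G (x₀, t)) (fderiv ℝ G (x₀, μ x₀) ∘L .inr ℝ E ℝ) (μ x₀) :=
      HasFDerivAt.comp (g := G) (μ x₀) (hG.differentiableAt hne).hasFDerivAt
        (hasFDerivAt_prodMk_right x₀ (μ x₀))
    exact h1.unique hd.hasFDerivAt
  have hinv : (fderiv ℝ G (x₀, μ x₀) ∘L .inr ℝ E ℝ).IsInvertible := by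
    rw [hinr]
    refine ⟨ContinuousLinearEquiv.unitsEquivAut ℝ (Units.mk0 c hc), ?_⟩
    ext
    simp
  refine (hG.contDiffAt_implicitFunction hne hinv).congr_of_eventuallyEq ?_
  have ht : Filter.Tendsto (fun x => (x, μ x)) (𝓝 x₀) (𝓝 (x₀, μ x₀)) :=
    continuousAt_id.prodMk hμ
  filter_upwards [ht.eventually (hG.eventually_apply_eq_iff_implicitFunction hne hinv), h0]
    with x hx hx0
  exact (hx.mp (hx0.trans h0.self_of_nhds.symm)).symm

theorem eventually_mult_nodes_eq (hcoef : ∀ k θ, AnAt (fun θ => (rootPoly (lam θ)).coeff k) θ)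
    {Θ : Torus d} (hΘ : ∀ᶠ θ in 𝓝 Θ, (Finset.univ.image (lam θ)).card = m) :
    ∀ᶠ θ in 𝓝 Θ, ∀ σ : Fin m,
      mult (lam θ) (nodes m (lam θ) σ) = mult (lam Θ) (nodes m (lam Θ) σ) := by
  -- multiplicities are upper semicontinuous, and their sum is constant
  have hle : ∀ᶠ θ in 𝓝 Θ, ∀ σ : Fin m,
      mult (lam θ) (nodes m (lam θ) σ) ≤ mult (lam Θ) (nodes m (lam Θ) σ) := by
    rw [Filter.eventually_all]
    intro σ
    obtain ⟨k, hk, hne⟩ : ∃ k ≤ mult (lam Θ) (nodes m (lam Θ) σ),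
        (Polynomial.derivative^[k] (rootPoly (lam Θ))).eval (nodes m (lam Θ) σ) ≠ 0 := by
      by_contra! h
      have := (Polynomial.lt_rootMultiplicity_iff_isRoot_iterate_derivative
        (rootPoly_ne_zero (lam Θ))).mpr fun k hk => h k hk
      rw [rootMultiplicity_rootPoly] at this
      exact lt_irrefl _ this
    have hc : ContinuousAt (fun θ =>
        (Polynomial.derivative^[k] (rootPoly (lam θ))).eval (nodes m (lam θ) σ)) Θ := by
      obtain ⟨x, rfl⟩ := exists_proj_eq Θ
      rw [← isOpenQuotientMap_proj.continuousAt_comp_iff]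
      exact ContinuousAt.comp
        (f := fun y => (y, nodes m (lam (Torus.proj y)) σ))
        (contDiffAt_eval_derivative hcoef k _).continuousAt
        (continuousAt_id.prodMk ((continuousAt_nodes hcoef hΘ σ).comp
          isOpenQuotientMap_proj.continuous.continuousAt))
    filter_upwards [hc.eventually_ne hne] with θ hθ
    by_contra! hlt
    rw [← rootMultiplicity_rootPoly (lam θ)] at hlt
    exact hθ ((Polynomial.lt_rootMultiplicity_iff_isRoot_iterate_derivative
      (rootPoly_ne_zero (lam θ))).mp hlt k hk)
  filter_upwards [hΘ, hle] with θ hθ hl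
  have hsum : ∑ σ, mult (lam θ) (nodes m (lam θ) σ) = ∑ σ, mult (lam Θ) (nodes m (lam Θ) σ) := by
    rw [sum_mult_nodes hθ, sum_mult_nodes hΘ.self_of_nhds]
  exact fun σ => (Finset.sum_eq_sum_iff_of_le fun σ _ => hl σ).mp hsum σ (Finset.mem_univ σ)

/-- Where the number of distinct roots is constant, these roots are real-analytic: a root of
multiplicity `k + 1` is a simple root of the `k`-th derivative of the polynomial. -/
theorem anAt_nodes (hcoef : ∀ k θ, AnAt (fun θ => (rootPoly (lam θ)).coeff k) θ)
    {Θ : Torus d} (hΘ : ∀ᶠ θ in 𝓝 Θ, (Finset.univ.image (lam θ)).card = m) (σ : Fin m) :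
    AnAt (fun θ => nodes m (lam θ) σ) Θ := by
  rintro x rfl
  have hcard := hΘ.self_of_nhds
  have hproj : ContinuousAt Torus.proj x := isOpenQuotientMap_proj.continuous.continuousAt
  have hpos : 0 < mult (lam (Torus.proj x)) (nodes m (lam (Torus.proj x)) σ) := by
    obtain ⟨i, hi⟩ : nodes m (lam (Torus.proj x)) σ ∈ Set.range (lam (Torus.proj x)) := by
      rw [← range_nodes hcard]; exact ⟨σ, rfl⟩
    exact Finset.card_pos.mpr ⟨i, by simpa using hi⟩
  obtain ⟨k, hk⟩ := Nat.exists_eq_add_one_of_ne_zero hpos.ne'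
  have hroot : ∀ θ, mult (lam θ) (nodes m (lam θ) σ) = k + 1 → ∀ j ≤ k,
      (Polynomial.derivative^[j] (rootPoly (lam θ))).eval (nodes m (lam θ) σ) = 0 :=
    fun θ hθ => (Polynomial.lt_rootMultiplicity_iff_isRoot_iterate_derivative
      (rootPoly_ne_zero (lam θ))).mp (by rw [rootMultiplicity_rootPoly, hθ]; omega)
  refine contDiffAt_of_implicit
    (G := fun u => (Polynomial.derivative^[k] (rootPoly (lam (Torus.proj u.1)))).eval u.2)
    (c := (Polynomial.derivative^[k + 1] (rootPoly (lam (Torus.proj x)))).eval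
      (nodes m (lam (Torus.proj x)) σ))
    (contDiffAt_eval_derivative hcoef k _) ?_ ?_ ((continuousAt_nodes hcoef hΘ σ).comp hproj) ?_
  · rw [Function.iterate_succ_apply']
    exact (Polynomial.derivative^[k] (rootPoly (lam (Torus.proj x)))).hasDerivAt _
  · intro h0
    have := (Polynomial.lt_rootMultiplicity_iff_isRoot_iterate_derivative (n := k + 1)
      (rootPoly_ne_zero (lam (Torus.proj x)))).mpr fun j hj => by
        rcases Nat.lt_or_ge k j with h | h
        · obtain rfl : j = k + 1 := by omega
          exact h0
        · exact hroot _ hk j h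
    rw [rootMultiplicity_rootPoly, hk] at this
    exact lt_irrefl _ this
  · filter_upwards [hproj.eventually (eventually_mult_nodes_eq hcoef hΘ)] with y hy
    exact hroot _ ((hy σ).trans hk) k le_rfl

theorem anAt_levels (hcoef : ∀ k θ, AnAt (fun θ => (rootPoly (lam θ)).coeff k) θ)
    {Θ : Torus d} (hΘ : ∀ᶠ θ in 𝓝 Θ, (Finset.univ.image (lam θ)).card = m)
    (κ : Fin n → Fin m) (σ : Fin m) : AnAt (fun θ => levels κ (lam θ) σ) Θ := by
  refine (anAt_nodes hcoef hΘ
    (arrange κ (fun ν => mult (lam Θ) (nodes m (lam Θ) ν)) σ)).congr ?_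
  filter_upwards [eventually_mult_nodes_eq hcoef hΘ] with θ hθ
  rw [levels, funext hθ]

end Families

/-! ### Functions of a Hermitian matrix -/

section SpecFun

variable {n : ℕ} {A : Matrix (Fin n) (Fin n) ℂ} (hA : A.IsHermitian)

/-- The function `f` of a Hermitian matrix: the eigenvectors are kept and each eigenvalue `a` is
replaced by `f a`. Unlike `cfc` over `ℝ` it allows complex values. -/
noncomputable def specFun (f : ℝ → ℂ) : Matrix (Fin n) (Fin n) ℂ :=
  (hA.eigenvectorUnitary : Matrix (Fin n) (Fin n) ℂ) *
    Matrix.diagonal (fun i => f (hA.eigenvalues i)) *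
    star (hA.eigenvectorUnitary : Matrix (Fin n) (Fin n) ℂ)

theorem specFun_congr {f g : ℝ → ℂ} (h : ∀ t ∈ Set.range hA.eigenvalues, f t = g t) :
    specFun hA f = specFun hA g := by
  simp only [specFun, h _ ⟨_, rfl⟩]

theorem specFun_mul (f g : ℝ → ℂ) :
    specFun hA f * specFun hA g = specFun hA fun t => f t * g t := by
  set U := (hA.eigenvectorUnitary : Matrix (Fin n) (Fin n) ℂ) with hU
  have h : star U * U = 1 := Unitary.coe_star_mul_self hA.eigenvectorUnitary
  calc _ = U * Matrix.diagonal (fun i => f (hA.eigenvalues i)) * (star U * U) *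
        Matrix.diagonal (fun i => g (hA.eigenvalues i)) * star U := by
        simp only [specFun, ← hU, Matrix.mul_assoc]
    _ = _ := by
        rw [h, Matrix.mul_one, Matrix.mul_assoc U, Matrix.diagonal_mul_diagonal]
        rfl

theorem specFun_const (c : ℂ) : specFun hA (fun _ => c) = c • 1 := by
  have h := Unitary.coe_mul_star_self hA.eigenvectorUnitary
  rw [specFun, ← Matrix.smul_one_eq_diagonal, Matrix.mul_smul, Matrix.mul_one, Matrix.smul_mul]
  exact congrArg (c • ·) h

theorem specFun_add (f g : ℝ → ℂ) :
    specFun hA (fun t => f t + g t) = specFun hA f + specFun hA g := by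
  rw [specFun, ← Matrix.diagonal_add, Matrix.mul_add, Matrix.add_mul]
  rfl

theorem specFun_sub (f g : ℝ → ℂ) :
    specFun hA (fun t => f t - g t) = specFun hA f - specFun hA g := by
  rw [specFun, ← Matrix.diagonal_sub, Matrix.mul_sub, Matrix.sub_mul]
  rfl

theorem specFun_smul (c : ℂ) (f : ℝ → ℂ) :
    specFun hA (fun t => c * f t) = c • specFun hA f := by
  rw [← specFun_mul hA (fun _ => c) f, specFun_const, Matrix.smul_mul, Matrix.one_mul]

theorem specFun_sum {ι : Type*} (s : Finset ι) (f : ι → ℝ → ℂ) :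
    specFun hA (fun t => ∑ i ∈ s, f i t) = ∑ i ∈ s, specFun hA (f i) := by
  classical
  induction s using Finset.induction_on with
  | empty => simpa using specFun_const hA 0
  | insert i s hi ih => simp only [Finset.sum_insert hi, specFun_add, ih]

theorem specFun_list_prod {ι : Type*} (l : List ι) (f : ι → ℝ → ℂ) :
    specFun hA (fun t => (l.map fun i => f i t).prod) = (l.map fun i => specFun hA (f i)).prod := by
  induction l with
  | nil => simpa using specFun_const hA 1
  | cons i l ih =>
    simp only [List.map_cons, List.prod_cons]
    rw [← specFun_mul hA (f i) fun t => (l.map fun i => f i t).prod, ih]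

theorem star_specFun (f : ℝ → ℂ) : star (specFun hA f) = specFun hA fun t => star (f t) := by
  rw [specFun, star_mul, star_mul, star_star, Matrix.star_eq_conjTranspose (Matrix.diagonal _),
    Matrix.diagonal_conjTranspose, ← Matrix.mul_assoc]
  rfl

theorem specFun_ofReal : specFun hA (fun t => (t : ℂ)) = A := by
  conv_rhs => rw [hA.spectral_theorem]
  rfl

theorem charpoly_specFun (f : ℝ → ℂ) : (specFun hA f).charpoly =
    ∏ i, (Polynomial.X - Polynomial.C (f (hA.eigenvalues i))) := by
  rw [specFun, Matrix.charpoly_mul_comm, ← Matrix.mul_assoc,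
    Unitary.coe_star_mul_self hA.eigenvectorUnitary, Matrix.one_mul, Matrix.charpoly_diagonal]

/-- If `g` is injective, an eigenvector of `g(A)` for the value `g t` is an eigenvector of every
`f(A)`, for the value `f t`: `f - f t` is a multiple of `g - g t`. -/
theorem specFun_mulVec_eq {g : ℝ → ℂ} (hg : Function.Injective g) (f : ℝ → ℂ) {t : ℝ}
    {x : Fin n → ℂ} (hx : (specFun hA g).mulVec x = g t • x) :
    (specFun hA f).mulVec x = f t • x := by
  have h : specFun hA f = specFun hA (fun u => (f u - f t) / (g u - g t)) *
      (specFun hA g - g t • 1) + f t • 1 := by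
    rw [← specFun_const hA (g t), ← specFun_sub, specFun_mul, ← specFun_const hA (f t),
      ← specFun_add]
    refine specFun_congr hA fun u _ => ?_
    by_cases hu : u = t
    · simp [hu]
    · have : g u - g t ≠ 0 := sub_ne_zero.mpr (hg.ne hu)
      field_simp
      ring
  rw [h, Matrix.add_mulVec, ← Matrix.mulVec_mulVec, Matrix.sub_mulVec, hx]
  simp [Matrix.smul_mulVec]

end SpecFun

/-- The principal square root on the real line. -/
noncomputable def rootFun (t : ℝ) : ℂ := (Real.sqrt t : ℂ) + Complex.I * (Real.sqrt (-t) : ℂ)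

theorem rootFun_injective : Function.Injective rootFun := by
  -- `t` is recovered as the difference of the squares of the real and the imaginary part
  have h : ∀ t, (rootFun t).re ^ 2 - (rootFun t).im ^ 2 = t := fun t => by
    have h1 : (rootFun t).re = Real.sqrt t := by simp [rootFun]
    have h2 : (rootFun t).im = Real.sqrt (-t) := by simp [rootFun]
    rw [h1, h2]
    rcases le_total 0 t with ht | ht
    · rw [Real.sq_sqrt ht, Real.sqrt_eq_zero_of_nonpos (by linarith)]; ring
    · rw [Real.sqrt_eq_zero_of_nonpos ht, Real.sq_sqrt (neg_nonneg.mpr ht)]; ring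
  intro s t hst
  rw [← h s, ← h t, hst]

theorem rootFun_of_nonneg {t : ℝ} (ht : 0 ≤ t) : rootFun t = (Real.sqrt t : ℂ) := by
  simp [rootFun, Real.sqrt_eq_zero_of_nonpos (neg_nonpos.mpr ht)]

theorem principalSqrt_eq_specFun {n : ℕ} {A : Matrix (Fin n) (Fin n) ℂ} (hA : A.IsHermitian) :
    principalSqrt A = specFun hA rootFun := by
  have h : ∀ f : ℝ → ℝ, cfc f A = specFun hA fun t => (f t : ℂ) := fun f => by
    rw [hA.cfc_eq f, Matrix.IsHermitian.cfc]
    rfl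
  rw [principalSqrt, h, h, ← specFun_smul, ← specFun_add]
  rfl

theorem AnAt.rootFun {d : ℕ} {f : Torus d → ℝ} {θ : Torus d} (hf : AnAt f θ) (h0 : f θ ≠ 0) :
    AnAt (fun η => rootFun (f η)) θ := by
  have hneg : AnAt (fun η => -f η) θ := by
    simpa using (anAt_const (0 : ℝ)).sub hf
  exact (hf.sqrt h0).ofReal.add
    ((anAt_const Complex.I).mul (hneg.sqrt (neg_ne_zero.mpr h0)).ofReal)

/-! ### Spectral projections -/

section Projections

variable {n m : ℕ} {A : Matrix (Fin n) (Fin n) ℂ} (hA : A.IsHermitian)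

open Classical in
/-- The orthogonal projection onto the eigenspace of a Hermitian matrix for the value `t` (zero if
`t` is not an eigenvalue). -/
noncomputable def specProj (t : ℝ) : Matrix (Fin n) (Fin n) ℂ :=
  specFun hA fun u => if u = t then 1 else 0

theorem isStarProjection_specProj (t : ℝ) : IsStarProjection (specProj hA t) := by
  classical
  refine ⟨?_, ?_⟩
  · rw [IsIdempotentElem, specProj, specFun_mul]
    refine specFun_congr hA fun u _ => ?_
    split_ifs <;> simp
  · rw [IsSelfAdjoint, specProj, star_specFun]
    refine specFun_congr hA fun u _ => ?_
    split_ifs <;> simp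

theorem specFun_mul_specProj (f : ℝ → ℂ) (t : ℝ) :
    specFun hA f * specProj hA t = f t • specProj hA t := by
  rw [specProj, specFun_mul, ← specFun_smul]
  refine specFun_congr hA fun u _ => ?_
  by_cases hu : u = t <;> simp [hu]

theorem range_specProj {g : ℝ → ℂ} (hg : Function.Injective g) (t : ℝ) :
    LinearMap.range (Matrix.toLin' (specProj hA t)) =
      Module.End.eigenspace (Matrix.toLin' (specFun hA g)) (g t) := by
  ext x
  rw [LinearMap.mem_range, Module.End.mem_eigenspace_iff]
  constructor
  · rintro ⟨y, rfl⟩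
    rw [Matrix.toLin'_apply, Matrix.toLin'_apply, Matrix.mulVec_mulVec, specFun_mul_specProj,
      Matrix.smul_mulVec]
  · intro hx
    refine ⟨x, ?_⟩
    rw [Matrix.toLin'_apply] at hx ⊢
    simpa [specProj] using specFun_mulVec_eq hA hg (fun u => if u = t then 1 else 0) hx

variable {v : Fin m → ℝ}

theorem specFun_eq_sum_specProj (hv : Function.Injective v)
    (hr : Set.range v = Set.range hA.eigenvalues) (f : ℝ → ℂ) :
    specFun hA f = ∑ σ, f (v σ) • specProj hA (v σ) := by
  classical
  simp only [specProj, ← specFun_smul]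
  rw [← specFun_sum]
  refine specFun_congr hA fun u hu => ?_
  obtain ⟨σ, rfl⟩ := hr.symm ▸ hu
  simp [hv.eq_iff]

/-- Lagrange interpolation: the spectral projections are polynomials in the matrix. -/
theorem specProj_eq_list_prod (hv : Function.Injective v)
    (hr : Set.range v = Set.range hA.eigenvalues) (σ : Fin m) :
    specProj hA (v σ) = ((Finset.univ.erase σ).toList.map fun ν =>
      ((v σ : ℂ) - v ν)⁻¹ • (A - (v ν : ℂ) • 1)).prod := by
  classical
  have h : ∀ ν, ((v σ : ℂ) - v ν)⁻¹ • (A - (v ν : ℂ) • 1) =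
      specFun hA fun u => ((v σ : ℂ) - v ν)⁻¹ * ((u : ℂ) - v ν) := fun ν => by
    rw [specFun_smul, specFun_sub, specFun_ofReal, specFun_const]
  simp only [h]
  rw [← specFun_list_prod, specProj]
  refine specFun_congr hA fun u hu => ?_
  obtain ⟨μ, rfl⟩ := hr.symm ▸ hu
  rw [Finset.prod_map_toList]
  split_ifs with hμ
  · obtain rfl := hv hμ
    refine (Finset.prod_eq_one fun ν hν => inv_mul_cancel₀ (sub_ne_zero.mpr ?_)).symm
    exact_mod_cast hv.ne (Finset.ne_of_mem_erase hν).symm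
  · refine (Finset.prod_eq_zero (i := μ) ?_ (by simp)).symm
    exact Finset.mem_erase.mpr ⟨fun h => hμ (by rw [h]), Finset.mem_univ _⟩

end Projections

/-! ### Matrices depending analytically on a parameter -/

section MatrixAnalytic

variable {d n : ℕ} {θ : Torus d} {F G : Torus d → Matrix (Fin n) (Fin n) ℂ}

theorem matrixAnalyticAt_iff : MatrixAnalyticAt F θ ↔ ∀ k l, AnAt (fun η => F η k l) θ :=
  forall₂_congr fun _ _ => anAt_iff_realAnalyticAt.symm

theorem matrixAnalyticAt_const (M : Matrix (Fin n) (Fin n) ℂ) :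
    MatrixAnalyticAt (fun _ : Torus d => M) θ :=
  matrixAnalyticAt_iff.mpr fun k l => anAt_const (M k l)

theorem MatrixAnalyticAt.mul (hF : MatrixAnalyticAt F θ) (hG : MatrixAnalyticAt G θ) :
    MatrixAnalyticAt (fun η => F η * G η) θ := by
  rw [matrixAnalyticAt_iff] at *
  intro k l
  simp only [Matrix.mul_apply]
  exact AnAt.sum fun i _ => (hF k i).mul (hG i l)

theorem MatrixAnalyticAt.sub (hF : MatrixAnalyticAt F θ) (hG : MatrixAnalyticAt G θ) :
    MatrixAnalyticAt (fun η => F η - G η) θ := by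
  rw [matrixAnalyticAt_iff] at *
  exact fun k l => (hF k l).sub (hG k l)

theorem MatrixAnalyticAt.smul {c : Torus d → ℂ} (hc : AnAt c θ) (hF : MatrixAnalyticAt F θ) :
    MatrixAnalyticAt (fun η => c η • F η) θ := by
  rw [matrixAnalyticAt_iff] at *
  exact fun k l => hc.mul (hF k l)

theorem MatrixAnalyticAt.list_prod {ι : Type*} (l : List ι)
    {F : ι → Torus d → Matrix (Fin n) (Fin n) ℂ} (hF : ∀ i ∈ l, MatrixAnalyticAt (F i) θ) :
    MatrixAnalyticAt (fun η => (l.map fun i => F i η).prod) θ := by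
  induction l with
  | nil => simpa using matrixAnalyticAt_const 1
  | cons i l ih =>
    simp only [List.map_cons, List.prod_cons]
    exact (hF i List.mem_cons_self).mul (ih fun j hj => hF j (List.mem_cons_of_mem i hj))

theorem MatrixAnalyticAt.congr (hF : MatrixAnalyticAt F θ) (h : ∀ᶠ η in 𝓝 θ, G η = F η) :
    MatrixAnalyticAt G θ := by
  rw [matrixAnalyticAt_iff] at *
  exact fun k l => (hF k l).congr (h.mono fun η hη => by rw [hη])

theorem charpoly_eq_map_rootPoly {A : Matrix (Fin n) (Fin n) ℂ} (hA : A.IsHermitian) :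
    A.charpoly = (rootPoly hA.eigenvalues).map Complex.ofRealHom := by
  conv_lhs => rw [← specFun_ofReal hA, charpoly_specFun]
  simp [rootPoly, Polynomial.map_prod]

theorem anAt_coeff_charpoly (hF : MatrixAnalyticAt F θ) (k : ℕ) :
    AnAt (fun η => (F η).charpoly.coeff k) θ := by
  have h : ∀ η, (F η).charpoly.coeff k = ((Matrix.charpoly.univ ℂ (Fin n)).coeff k).eval₂
      (RingHom.id ℂ) fun q : Fin n × Fin n => F η q.1 q.2 := fun η =>
    (Matrix.charpoly.univ_coeff_eval₂Hom (Fin n) (RingHom.id ℂ)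
      (fun q : Fin n × Fin n => F η q.1 q.2) k).symm
  simp only [h]
  exact AnAt.mvPolynomial_eval₂ (RingHom.id ℂ) (f := fun (q : Fin n × Fin n) η => F η q.1 q.2)
    (fun q => matrixAnalyticAt_iff.mp hF q.1 q.2) _

/-- The coefficients of the real characteristic polynomial of an analytic family of Hermitian
matrices are analytic. -/
theorem anAt_coeff_rootPoly_eigenvalues (hH : ∀ η, (F η).IsHermitian)
    (hF : MatrixAnalyticAt F θ) (k : ℕ) :
    AnAt (fun η => (rootPoly (hH η).eigenvalues).coeff k) θ := by
  have h : ∀ η, (rootPoly (hH η).eigenvalues).coeff k = ((F η).charpoly.coeff k).re := fun η => by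
    rw [charpoly_eq_map_rootPoly (hH η), Polynomial.coeff_map]
    simp
  simp only [h]
  exact (anAt_coeff_charpoly hF k).re

end MatrixAnalytic

/-! ### The symbol -/

section Symbol

variable {d n : ℕ} {V : (Fin d → ℤ) → Matrix (Fin n) (Fin n) ℝ}

theorem star_character (z : Fin d → ℤ) (θ : Torus d) :
    star (character z θ) = character (-z) θ := by
  simp only [character, star_prod, Pi.neg_apply, fourier_neg]
  rfl

theorem symbol_isHermitian (hV : SymmetricKernel V) (θ : Torus d) : (symbol V θ).IsHermitian := by
  ext k l
  simp only [symbol, Matrix.conjTranspose_apply, Matrix.of_apply, tsum_star, star_mul',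
    star_character]
  rw [← (Equiv.neg (Fin d → ℤ)).tsum_eq]
  refine tsum_congr fun z => ?_
  simp [hV k l z]

theorem symbol_analytic (hV : ExpDecay V) (θ : Torus d) : MatrixAnalyticAt (symbol V) θ := by
  obtain ⟨C, α, hC, hα, h⟩ := hV
  intro k l x _
  exact analyticAt_fourierSeries hC hα (fun z => by simpa using h k l z) x

end Symbol

/-! ### Orthonormal frames of eigenvectors -/

section Frames

open InnerProductSpace

variable {n m : ℕ}

/-- The unitary matrix whose columns are obtained from a family of vectors by the Gram–Schmidt
process. -/
noncomputable def frameMatrix (w : Fin n → EuclideanSpace ℂ (Fin n)) :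
    Matrix (Fin n) (Fin n) ℂ :=
  Matrix.of fun j k => gramSchmidtNormed ℂ w k j

theorem frameMatrix_mem_unitaryGroup {w : Fin n → EuclideanSpace ℂ (Fin n)}
    (hw : LinearIndependent ℂ w) : frameMatrix w ∈ Matrix.unitaryGroup (Fin n) ℂ := by
  rw [Matrix.mem_unitaryGroup_iff']
  ext k l
  have h := orthonormal_iff_ite.mp (gramSchmidtNormed_orthonormal (𝕜 := ℂ) hw) k l
  rw [Matrix.one_apply, ← h, EuclideanSpace.inner_eq_star_dotProduct, dotProduct_comm]
  rfl

/-- The Gram–Schmidt process does not leave pairwise orthogonal subspaces. -/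
theorem gramSchmidt_mem_of_orthogonal {E : Type*} [NormedAddCommGroup E] [InnerProductSpace ℂ E]
    {κ : Fin n → Fin m} {S : Fin m → Submodule ℂ E}
    (hS : ∀ σ ν, σ ≠ ν → ∀ x ∈ S σ, ∀ y ∈ S ν, inner ℂ x y = 0)
    {w : Fin n → E} (hw : ∀ k, w k ∈ S (κ k)) (k : Fin n) :
    gramSchmidt ℂ w k ∈ S (κ k) := by
  induction k using WellFoundedLT.induction with
  | ind k ih =>
    rw [← sub_eq_iff_eq_add.mpr (gramSchmidt_def'' ℂ w k)]
    refine (S (κ k)).sub_mem (hw k) ((S (κ k)).sum_mem fun i hi => ?_)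
    have hlt := Finset.mem_Iio.mp hi
    by_cases h : κ i = κ k
    · exact (S (κ k)).smul_mem _ (h ▸ ih i hlt)
    · rw [hS _ _ h _ (ih i hlt) _ (hw k)]
      simp

/-- An eigenbasis of a Hermitian matrix, orthonormalized by the Gram–Schmidt process, diagonalizes
all functions of the matrix. -/
theorem specFun_eq_frameMatrix {A : Matrix (Fin n) (Fin n) ℂ} (hA : A.IsHermitian)
    {κ : Fin n → Fin m} {v : Fin m → ℝ} (hv : Function.Injective v)
    {w : Fin n → EuclideanSpace ℂ (Fin n)} (hli : LinearIndependent ℂ w)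
    (hw : ∀ k, A.mulVec (w k).ofLp = (v (κ k) : ℂ) • (w k).ofLp) (f : ℝ → ℂ) :
    specFun hA f = frameMatrix w * Matrix.diagonal (fun k => f (v (κ k))) *
      (frameMatrix w).conjTranspose := by
  have hw' : ∀ k, w k ∈ Module.End.eigenspace (Matrix.toEuclideanLin A) (v (κ k) : ℂ) :=
    fun k => by
      rw [Module.End.mem_eigenspace_iff]
      exact congrArg (WithLp.toLp 2) (hw k)
  have horth := (Matrix.isSymmetric_toEuclideanLin_iff.mpr hA).orthogonalFamily_eigenspaces
  have hgs := gramSchmidt_mem_of_orthogonal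
    (S := fun σ => Module.End.eigenspace (Matrix.toEuclideanLin A) (v σ : ℂ))
    (fun σ ν hne x hx y hy => horth (Complex.ofReal_injective.ne (hv.ne hne)) ⟨x, hx⟩ ⟨y, hy⟩) hw'
  have hcol : ∀ k, (specFun hA f).mulVec (gramSchmidtNormed ℂ w k).ofLp =
      f (v (κ k)) • (gramSchmidtNormed ℂ w k).ofLp := fun k => by
    refine specFun_mulVec_eq hA Complex.ofReal_injective f ?_
    rw [specFun_ofReal]
    have := (Module.End.eigenspace (Matrix.toEuclideanLin A) (v (κ k) : ℂ)).smul_mem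
      (‖gramSchmidt ℂ w k‖ : ℂ)⁻¹ (hgs k)
    rw [Module.End.mem_eigenspace_iff] at this
    exact congrArg WithLp.ofLp this
  have hmul : specFun hA f * frameMatrix w =
      frameMatrix w * Matrix.diagonal (fun k => f (v (κ k))) := by
    ext j k
    rw [Matrix.mul_diagonal]
    exact (congrFun (hcol k) j).trans (mul_comm _ _)
  have hU := Matrix.mem_unitaryGroup_iff.mp (frameMatrix_mem_unitaryGroup hli)
  rw [← hmul, Matrix.mul_assoc, ← Matrix.star_eq_conjTranspose, hU, Matrix.mul_one]

theorem anAt_of_coordinates {d : ℕ} {θ : Torus d} {f : Torus d → EuclideanSpace ℂ (Fin n)}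
    (hf : ∀ j, AnAt (fun η => f η j) θ) : AnAt f θ := by
  have h : f = fun η => ∑ j, f η j • EuclideanSpace.basisFun (Fin n) ℂ j :=
    funext fun η => ((EuclideanSpace.basisFun (Fin n) ℂ).sum_repr (f η)).symm
  rw [h]
  exact AnAt.sum fun j _ => AnAt.smul (hf j) (anAt_const _)

theorem matrixAnalyticAt_frameMatrix {d : ℕ} {θ : Torus d}
    {w : Torus d → Fin n → EuclideanSpace ℂ (Fin n)}
    (hw : ∀ k, AnAt (fun η => w η k) θ) (hli : LinearIndependent ℂ (w θ)) :
    MatrixAnalyticAt (fun η => frameMatrix (w η)) θ := by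
  have hnorm : ∀ k, AnAt (fun η => gramSchmidt ℂ (w η) k) θ →
      AnAt (fun η => (‖gramSchmidt ℂ (w η) k‖ : ℂ)) θ := fun k hk x hx => by
    subst hx
    exact AnAt.ofReal (f := fun η => ‖gramSchmidt ℂ (w η) k‖) (fun y hy => (hk y hy).norm ℂ
      (by simpa only [hy] using gramSchmidt_ne_zero k hli)) x rfl
  have hne : ∀ k, (‖gramSchmidt ℂ (w θ) k‖ : ℂ) ≠ 0 := fun k => by
    simpa using gramSchmidt_ne_zero k hli
  have hgs : ∀ k, AnAt (fun η => gramSchmidt ℂ (w η) k) θ := fun k => by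
    induction k using WellFoundedLT.induction with
    | ind k ih =>
      have h : ∀ η, gramSchmidt ℂ (w η) k = w η k - ∑ i ∈ Finset.Iio k,
          (inner ℂ (gramSchmidt ℂ (w η) i) (w η k) * ((‖gramSchmidt ℂ (w η) i‖ : ℂ) *
            (‖gramSchmidt ℂ (w η) i‖ : ℂ))⁻¹) • gramSchmidt ℂ (w η) i := fun η => by
        rw [← sub_eq_iff_eq_add.mpr (gramSchmidt_def'' ℂ (w η) k)]
        simp only [div_eq_mul_inv, pow_two]
        rfl
      simp only [h]
      refine (hw k).sub (AnAt.sum fun i hi => ?_)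
      have hi' := ih i (Finset.mem_Iio.mp hi)
      exact AnAt.smul ((AnAt.inner hi' (hw k)).mul
        (((hnorm i hi').mul (hnorm i hi')).inv (mul_ne_zero (hne i) (hne i)))) hi'
  rw [matrixAnalyticAt_iff]
  intro j k
  have h : AnAt (fun η => gramSchmidtNormed ℂ (w η) k) θ :=
    AnAt.smul ((hnorm k (hgs k)).inv (hne k)) (hgs k)
  exact AnAt.comp (g := fun u : EuclideanSpace ℂ (Fin n) => u j)
    ((EuclideanSpace.proj (𝕜 := ℂ) j).restrictScalars ℝ).contDiff.contDiffAt h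

end Frames

/-! ### Consecutive blocks -/

section Blocks

variable {n m : ℕ}

/-- The colour classes of a monotone surjective colouring are consecutive blocks of indices. -/
theorem exists_blocks {κ : Fin n → Fin m} (hmono : Monotone κ) (hκ : Function.Surjective κ) :
    ∃ r : Fin (m + 1) → ℕ, StrictMono r ∧ r 0 = 0 ∧ r (Fin.last m) = n ∧
      ∀ σ k, InBlock r σ k ↔ κ k = σ := by
  let D : Fin (m + 1) → Finset (Fin n) := fun j => Finset.univ.filter fun k => (κ k : ℕ) < j
  have hlt : ∀ (j : Fin (m + 1)) (k : Fin n), (k : ℕ) < (D j).card ↔ (κ k : ℕ) < j := by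
    intro j k
    constructor
    · intro h
      by_contra! hge
      have hsub : D j ⊆ Finset.Iio k := fun i hi => by
        rw [Finset.mem_Iio]
        by_contra! hki
        have h1 : (κ i : ℕ) < j := (Finset.mem_filter.mp hi).2
        have h2 : (κ k : ℕ) ≤ κ i := hmono hki
        omega
      have := Finset.card_le_card hsub
      rw [Fin.card_Iio] at this
      omega
    · intro h
      have hsub : Finset.Iic k ⊆ D j := fun i hi => by
        refine Finset.mem_filter.mpr ⟨Finset.mem_univ _, ?_⟩
        have h2 : (κ i : ℕ) ≤ κ k := hmono (Finset.mem_Iic.mp hi)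
        omega
      have := Finset.card_le_card hsub
      rw [Fin.card_Iic] at this
      omega
  refine ⟨fun j => (D j).card, ?_, ?_, ?_, ?_⟩
  · refine Fin.strictMono_iff_lt_succ.mpr fun σ => ?_
    obtain ⟨k, hk⟩ := hκ σ
    have h1 : ¬ (k : ℕ) < (D σ.castSucc).card := by
      rw [hlt, hk]; simp
    have h2 : (k : ℕ) < (D σ.succ).card := by
      rw [hlt, hk]; simp
    omega
  · simp [D]
  · simp [D]
  · intro σ k
    rw [InBlock, hlt, ← not_lt, hlt, Fin.ext_iff]
    simp only [Fin.val_castSucc, Fin.val_succ]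
    omega

/-- Every finite family of reals has the pattern of a monotone colouring by its distinct values. -/
theorem exists_monotone_pattern {a : Fin n → ℝ} (h : (Finset.univ.image a).card = m) :
    ∃ κ : Fin n → Fin m, Monotone κ ∧ Function.Surjective κ ∧
      MvPolynomial.eval a (separator κ) ≠ 0 := by
  have hmem : ∀ k, ∃ σ, nodes m a σ = a (Tuple.sort a k) := fun k => by
    have : a (Tuple.sort a k) ∈ Set.range (nodes m a) := by
      rw [range_nodes h]; exact ⟨_, rfl⟩
    exact this
  choose κ hκ using hmem
  refine ⟨κ, fun k l hkl => ?_, fun σ => ?_, ?_⟩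
  · rw [← (nodes_strictMono h).le_iff_le, hκ, hκ]
    exact Tuple.monotone_sort a hkl
  · obtain ⟨i, hi⟩ : nodes m a σ ∈ Set.range a := by
      rw [← range_nodes h]; exact ⟨σ, rfl⟩
    refine ⟨(Tuple.sort a).symm i, (nodes_strictMono h).injective ?_⟩
    rw [hκ, Equiv.apply_symm_apply, hi]
  · refine (eval_separator_ne_zero_iff κ a).mpr ⟨Tuple.sort a, fun i j hne => ?_⟩
    rw [← hκ, ← hκ]
    exact (nodes_strictMono h).injective.ne hne

end Blocks

/-! ### Analytic families of Hermitian matrices -/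

section HermitianFamily

variable {d n : ℕ} {A : Torus d → Matrix (Fin n) (Fin n) ℂ}

/-- Off a closed null set the coincidences of the eigenvalues of an analytic Hermitian family follow
one fixed pattern, and the distinct eigenvalues and their principal square roots are analytic. -/
theorem exists_generic_pattern (hn : 1 ≤ n) (hH : ∀ θ, (A θ).IsHermitian)
    (hA : ∀ θ, MatrixAnalyticAt A θ) :
    ∃ (Cs : Set (Torus d)) (s : ℕ) (κ : Fin n → Fin (s + 1)), IsClosed Cs ∧ volume Cs = 0 ∧
      Monotone κ ∧ Function.Surjective κ ∧ ∀ θ ∉ Cs, HasPattern κ (hH θ).eigenvalues ∧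
        (∀ σ, AnAt (fun η => levels κ (hH η).eigenvalues σ) θ) ∧
        ∀ σ, AnAt (fun η => rootFun (levels κ (hH η).eigenvalues σ)) θ := by
  set lam : Torus d → Fin n → ℝ := fun θ => (hH θ).eigenvalues with hlam
  have hcoef : ∀ k θ, AnAt (fun θ => (rootPoly (lam θ)).coeff k) θ := fun k θ =>
    anAt_coeff_rootPoly_eigenvalues hH (hA θ) k
  -- the pattern is read off at a point `Θ₀` with the largest number of distinct eigenvalues
  obtain ⟨Θ₀, hmax⟩ : ∃ Θ₀, ∀ θ,
      (Finset.univ.image (lam θ)).card ≤ (Finset.univ.image (lam Θ₀)).card := by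
    have hbdd : BddAbove (Set.range fun θ => (Finset.univ.image (lam θ)).card) :=
      ⟨n, by rintro _ ⟨θ, rfl⟩; exact Finset.card_image_le.trans (Finset.card_fin n).le⟩
    obtain ⟨Θ₀, h⟩ := Nat.sSup_mem (Set.range_nonempty _) hbdd
    refine ⟨Θ₀, fun θ => ?_⟩
    have h' : (Finset.univ.image (lam Θ₀)).card = _ := h
    rw [h']
    exact le_csSup hbdd ⟨θ, rfl⟩
  obtain ⟨s, hs⟩ : ∃ s, (Finset.univ.image (lam Θ₀)).card = s + 1 :=
    Nat.exists_eq_add_one_of_ne_zero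
      (Finset.card_pos.mpr ⟨_, Finset.mem_image_of_mem _ (Finset.mem_univ (⟨0, hn⟩ : Fin n))⟩).ne'
  rw [hs] at hmax
  obtain ⟨κ, hmono, hκ, hsep⟩ := exists_monotone_pattern hs
  have hF := anAt_symmetric hcoef (separator_isSymmetric κ)
  have hD0 : ∀ θ, (rootPoly (lam θ)).coeff 0 = 0 ↔ 0 ∈ Set.range (lam θ) := fun θ => by
    rw [Polynomial.coeff_zero_eq_eval_zero, eval_rootPoly, Finset.prod_eq_zero_iff]
    simp
  -- points with a zero eigenvalue are exceptional too, unless zero is an eigenvalue everywhere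
  let Z : Set (Torus d) :=
    {θ | (rootPoly (lam θ)).coeff 0 = 0 ∧ ∃ η, (rootPoly (lam η)).coeff 0 ≠ 0}
  have hZ : IsClosed Z ∧ volume Z = 0 := by
    by_cases h : ∃ η, (rootPoly (lam η)).coeff 0 ≠ 0
    · have : Z = {θ | (rootPoly (lam θ)).coeff 0 = 0} := by ext; simp [Z, h]
      rw [this]
      exact ⟨isClosed_zeros (hcoef 0), volume_zeros_eq_zero (hcoef 0) h⟩
    · have : Z = ∅ := by ext; simp [Z, h]
      rw [this]
      exact ⟨isClosed_empty, measure_empty⟩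
  let Cs : Set (Torus d) := {θ | MvPolynomial.eval (lam θ) (separator κ) = 0} ∪ Z
  have hCs : IsClosed Cs := (isClosed_zeros hF).union hZ.1
  have hpat : ∀ θ ∉ Cs, HasPattern κ (lam θ) := fun θ hθ =>
    hasPattern_of_separator hκ (hmax θ) fun h => hθ (Or.inl h)
  have hlev : ∀ θ ∉ Cs, ∀ σ, AnAt (fun η => levels κ (lam η) σ) θ := fun θ hθ σ =>
    anAt_levels hcoef (Filter.mem_of_superset (hCs.isOpen_compl.mem_nhds hθ)
      fun η hη => (hpat η hη).card_image hκ) κ σ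
  refine ⟨Cs, s, κ, hCs, measure_union_null (volume_zeros_eq_zero hF ⟨Θ₀, hsep⟩) hZ.2, hmono, hκ,
    fun θ hθ => ⟨hpat θ hθ, hlev θ hθ, fun σ => ?_⟩⟩
  by_cases h0 : levels κ (lam θ) σ = 0
  · -- zero is then an eigenvalue everywhere, and the `σ`-th level is the only one close to zero
    have hDθ : (rootPoly (lam θ)).coeff 0 = 0 := by
      rw [hD0, ← (hpat θ hθ).range_levels hκ]
      exact ⟨σ, h0⟩
    have hall : ∀ η, (rootPoly (lam η)).coeff 0 = 0 := by
      by_contra! h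
      exact hθ (Or.inr ⟨hDθ, h⟩)
    have hother : ∀ᶠ η in 𝓝 θ, ∀ ν, ν ≠ σ → levels κ (lam η) ν ≠ 0 := by
      rw [Filter.eventually_all]
      intro ν
      by_cases hν : ν = σ
      · simp [hν]
      · have hne : levels κ (lam θ) ν ≠ 0 := fun h =>
          hν ((hpat θ hθ).levels_injective hκ (h.trans h0.symm))
        filter_upwards [(hlev θ hθ ν).continuousAt.eventually_ne hne] with η hη _ using hη
    refine (anAt_const (rootFun 0)).congr ?_
    filter_upwards [hother, hCs.isOpen_compl.mem_nhds hθ] with η h1 hη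
    obtain ⟨ν, hν⟩ : 0 ∈ Set.range (levels κ (lam η)) := by
      rw [(hpat η hη).range_levels hκ, ← hD0]
      exact hall η
    have : ν = σ := by
      by_contra hne
      exact h1 ν hne hν
    rw [← this, hν]
  · exact AnAt.rootFun (hlev θ hθ σ) h0

variable {s : ℕ} {κ : Fin n → Fin (s + 1)}

theorem matrixAnalyticAt_specProj (hH : ∀ θ, (A θ).IsHermitian) {v : Torus d → Fin (s + 1) → ℝ}
    {θ : Torus d} (hA : MatrixAnalyticAt A θ) (hv : ∀ σ, AnAt (fun η => v η σ) θ)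
    (hinj : ∀ᶠ η in 𝓝 θ, Function.Injective (v η))
    (hr : ∀ᶠ η in 𝓝 θ, Set.range (v η) = Set.range (hH η).eigenvalues) (σ : Fin (s + 1)) :
    MatrixAnalyticAt (fun η => specProj (hH η) (v η σ)) θ := by
  refine MatrixAnalyticAt.congr (MatrixAnalyticAt.list_prod ((Finset.univ.erase σ).toList)
    (F := fun ν η => ((v η σ : ℂ) - v η ν)⁻¹ • (A η - (v η ν : ℂ) • 1)) fun ν hν => ?_) ?_
  · have hne : ν ≠ σ := by simpa using hν
    have h0 : (v θ σ : ℂ) - v θ ν ≠ 0 :=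
      sub_ne_zero.mpr (by exact_mod_cast hinj.self_of_nhds.ne hne.symm)
    exact MatrixAnalyticAt.smul (((hv σ).ofReal.sub (hv ν).ofReal).inv h0)
      (hA.sub (MatrixAnalyticAt.smul (hv ν).ofReal (matrixAnalyticAt_const 1)))
  · filter_upwards [hinj, hr] with η h1 h2
    exact specProj_eq_list_prod (hH η) h1 h2 σ

/-- Local analytic diagonalization: the spectral projections carry an eigenbasis at `Θ` to
eigenvectors at nearby points, which the Gram–Schmidt process makes orthonormal. -/
theorem exists_analytic_frame (hH : ∀ θ, (A θ).IsHermitian) {v : Torus d → Fin (s + 1) → ℝ}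
    {U : Set (Torus d)} (hU : IsOpen U) {Θ : Torus d} (hΘ : Θ ∈ U)
    (hinj : ∀ η ∈ U, Function.Injective (v η))
    (hP : ∀ η ∈ U, ∀ σ, MatrixAnalyticAt (fun η => specProj (hH η) (v η σ)) η)
    (hperm : ∃ τ : Equiv.Perm (Fin n), ∀ k, (hH Θ).eigenvalues (τ k) = v Θ (κ k)) :
    ∃ O ⊆ U, IsOpen O ∧ Θ ∈ O ∧ ∃ B : Torus d → Matrix (Fin n) (Fin n) ℂ, ∀ θ ∈ O,
      MatrixAnalyticAt B θ ∧ B θ ∈ Matrix.unitaryGroup (Fin n) ℂ ∧ ∀ f : ℝ → ℂ,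
        specFun (hH θ) f =
          B θ * Matrix.diagonal (fun k => f (v θ (κ k))) * (B θ).conjTranspose := by
  obtain ⟨τ, hτ⟩ := hperm
  let b : Fin n → EuclideanSpace ℂ (Fin n) := fun k => (hH Θ).eigenvectorBasis (τ k)
  let w : Torus d → Fin n → EuclideanSpace ℂ (Fin n) := fun η k =>
    WithLp.toLp 2 ((specProj (hH η) (v η (κ k))).mulVec (b k).ofLp)
  have hwan : ∀ η ∈ U, ∀ k, AnAt (fun η => w η k) η := fun η hη k =>
    anAt_of_coordinates fun j => AnAt.sum (s := Finset.univ)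
      (f := fun i η => specProj (hH η) (v η (κ k)) j i * (b k).ofLp i)
      fun i _ => (matrixAnalyticAt_iff.mp (hP η hη (κ k)) j i).mul (anAt_const _)
  have hwb : w Θ = b := funext fun k => by
    have h1 : (specFun (hH Θ) fun t => (t : ℂ)).mulVec (b k).ofLp =
        ((v Θ (κ k) : ℝ) : ℂ) • (b k).ofLp := by
      rw [specFun_ofReal, ← hτ k]
      exact (hH Θ).mulVec_eigenvectorBasis (τ k)
    have h2 := specFun_mulVec_eq (hH Θ) Complex.ofReal_injective
      (fun u => if u = v Θ (κ k) then 1 else 0) h1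
    refine congrArg (WithLp.toLp 2) (?_ : _ = (b k).ofLp)
    simpa [specProj] using h2
  have hli : LinearIndependent ℂ (w Θ) := by
    rw [hwb]
    exact ((hH Θ).eigenvectorBasis.orthonormal.comp τ τ.injective).linearIndependent
  have hev : ∀ᶠ η in 𝓝 Θ, LinearIndependent ℂ (w η) :=
    (continuousAt_pi.mpr fun k => (hwan Θ hΘ k).continuousAt).eventually
      (isOpen_setOfPred_linearIndependent.mem_nhds hli)
  obtain ⟨O, hO, hOopen, hΘO⟩ := mem_nhds_iff.mp (Filter.inter_mem hev (hU.mem_nhds hΘ))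
  refine ⟨O, fun θ hθ => (hO hθ).2, hOopen, hΘO, fun η => frameMatrix (w η), fun θ hθ => ?_⟩
  obtain ⟨hliθ, hθU⟩ := hO hθ
  refine ⟨matrixAnalyticAt_frameMatrix (hwan θ hθU) hliθ, frameMatrix_mem_unitaryGroup hliθ,
    fun f => specFun_eq_frameMatrix (hH θ) (hinj θ hθU) hliθ (fun k => ?_) f⟩
  change (A θ).mulVec ((specProj (hH θ) (v θ (κ k))).mulVec (b k).ofLp) =
    _ • (specProj (hH θ) (v θ (κ k))).mulVec (b k).ofLp
  have h := specFun_mul_specProj (hH θ) (fun t => (t : ℂ)) (v θ (κ k))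
  rw [specFun_ofReal] at h
  rw [Matrix.mulVec_mulVec, h, Matrix.smul_mulVec]

end HermitianFamily

end Crystal

theorem lemma2p1 (d n : ℕ) (hd : 1 ≤ d) (hn : 1 ≤ n)
    (V : (Fin d → ℤ) → Matrix (Fin n) (Fin n) ℝ)
    (hE1 : Crystal.ExpDecay V) (hE2 : Crystal.SymmetricKernel V) :
    ∃ (Cs : Set (Crystal.Torus d)) (ω : Fin n → Crystal.Torus d → ℂ)
      (s : ℕ) (r : Fin (s + 2) → ℕ) (last : Fin (s + 1) → Fin n)
      (P : Fin (s + 1) → Crystal.Torus d → Matrix (Fin n) (Fin n) ℂ),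
      -- `ω₁(θ), …, ωₙ(θ)` are the eigenvalues of `Ω(θ)`, repeated by multiplicity
      (∀ θ, (Crystal.Omega V θ).charpoly = ∏ k, (Polynomial.X - Polynomial.C (ω k θ))) ∧
      -- they are real and non-negative wherever the symbol is non-negative definite
      (∀ θ, (Crystal.symbol V θ).PosSemidef → ∀ k, (ω k θ).im = 0 ∧ 0 ≤ (ω k θ).re) ∧
      -- the exceptional set is closed and null
      IsClosed Cs ∧ MeasureTheory.volume Cs = 0 ∧
      -- local real-analytic diagonalization
      (∀ Θ, Θ ∉ Cs → ∃ O : Set (Crystal.Torus d), IsOpen O ∧ Θ ∈ O ∧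
        (∀ k, ∀ θ ∈ O, Crystal.RealAnalyticAt (ω k) θ) ∧
        ∃ B : Crystal.Torus d → Matrix (Fin n) (Fin n) ℂ,
          ∀ θ ∈ O, Crystal.MatrixAnalyticAt B θ ∧
            B θ ∈ Matrix.unitaryGroup (Fin n) ℂ ∧
            Crystal.Omega V θ =
              B θ * Matrix.diagonal (fun k => ω k θ) * (B θ).conjTranspose) ∧
      -- the blocks of the enumeration: `0 = r₀ < r₁ < ⋯ < r_{s+1} = n`
      StrictMono r ∧ r 0 = 0 ∧ r (Fin.last (s + 1)) = n ∧
      -- constant multiplicity: eigenvalues coincide exactly within a block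
      (∀ θ, θ ∉ Cs → ∀ (σ ν : Fin (s + 1)) (k l : Fin n),
        Crystal.InBlock r σ k → Crystal.InBlock r ν l → (ω k θ = ω l θ ↔ σ = ν)) ∧
      -- `last σ` is the last index of the `σ`-th block
      (∀ σ, (last σ : ℕ) + 1 = r σ.succ) ∧
      -- `P σ θ` is the orthogonal projection onto the eigenspace, and depends analytically on `θ`
      (∀ θ, θ ∉ Cs → ∀ σ, IsStarProjection (P σ θ) ∧
        LinearMap.range (Matrix.toLin' (P σ θ)) =
          Module.End.eigenspace (Matrix.toLin' (Crystal.Omega V θ)) (ω (last σ) θ) ∧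
        Crystal.MatrixAnalyticAt (P σ) θ) ∧
      -- spectral decomposition
      (∀ θ, θ ∉ Cs → Crystal.Omega V θ = ∑ σ, ω (last σ) θ • P σ θ) := by
  classical
  have hH := Crystal.symbol_isHermitian hE2
  obtain ⟨Cs, s, κ, hCs, hnull, hmono, hκ, hgen⟩ :=
    Crystal.exists_generic_pattern hn hH (Crystal.symbol_analytic hE1)
  obtain ⟨r, hr, hr0, hrn, hblock⟩ := Crystal.exists_blocks hmono hκ
  -- off `Cs` the enumeration follows the blocks; on `Cs` any enumeration will do
  let v : Crystal.Torus d → Fin (s + 1) → ℝ := fun θ => Crystal.levels κ (hH θ).eigenvalues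
  let ω : Fin n → Crystal.Torus d → ℂ := fun k θ =>
    Crystal.rootFun (if θ ∈ Cs then (hH θ).eigenvalues k else v θ (κ k))
  have hω : ∀ θ ∉ Cs, ∀ k, ω k θ = Crystal.rootFun (v θ (κ k)) := fun θ hθ k => by
    simp only [ω, if_neg hθ]
  have hinj : ∀ θ ∉ Cs, Function.Injective (v θ) := fun θ hθ => (hgen θ hθ).1.levels_injective hκ
  have hrange : ∀ θ ∉ Cs, Set.range (v θ) = Set.range (hH θ).eigenvalues := fun θ hθ =>
    (hgen θ hθ).1.range_levels hκ
  have hOmega : ∀ θ, Crystal.Omega V θ = Crystal.specFun (hH θ) Crystal.rootFun := fun θ =>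
    Crystal.principalSqrt_eq_specFun (hH θ)
  have hnhds : ∀ θ ∉ Cs, ∀ᶠ η in nhds θ, η ∉ Cs := fun θ hθ => hCs.isOpen_compl.mem_nhds hθ
  have hP : ∀ θ ∉ Cs, ∀ σ,
      Crystal.MatrixAnalyticAt (fun η => Crystal.specProj (hH η) (v η σ)) θ := fun θ hθ σ =>
    Crystal.matrixAnalyticAt_specProj hH (Crystal.symbol_analytic hE1 θ) (hgen θ hθ).2.1
      ((hnhds θ hθ).mono hinj) ((hnhds θ hθ).mono hrange) σ
  have hlast : ∀ σ : Fin (s + 1), ∃ l : Fin n, (l : ℕ) + 1 = r σ.succ ∧ κ l = σ := fun σ => by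
    have h1 : r σ.castSucc < r σ.succ := hr Fin.castSucc_lt_succ
    have h2 : r σ.succ ≤ n := hrn ▸ hr.monotone (Fin.le_last _)
    refine ⟨⟨r σ.succ - 1, by omega⟩, by simp only; omega, (hblock _ _).mp ⟨?_, ?_⟩⟩
    · simp only; omega
    · simp only; omega
  choose last hlast1 hlast2 using hlast
  have hperm : ∀ θ, ∃ τ : Equiv.Perm (Fin n), ∀ k,
      ω k θ = Crystal.rootFun ((hH θ).eigenvalues (τ k)) := fun θ => by
    by_cases hθ : θ ∈ Cs
    · exact ⟨1, fun k => by simp only [ω, if_pos hθ, Equiv.Perm.one_apply]⟩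
    · obtain ⟨τ, hτ⟩ := (hgen θ hθ).1.exists_perm hκ
      exact ⟨τ, fun k => by rw [hω θ hθ, hτ]⟩
  refine ⟨Cs, ω, s, r, last, fun σ θ => Crystal.specProj (hH θ) (v θ σ), fun θ => ?_,
    fun θ hpos k => ?_, hCs, hnull, fun Θ hΘ => ?_, hr, hr0, hrn, fun θ hθ σ ν k l hk hl => ?_,
    hlast1, fun θ hθ σ => ⟨Crystal.isStarProjection_specProj _ _, ?_, hP θ hθ σ⟩,
    fun θ hθ => ?_⟩
  · obtain ⟨τ, hτ⟩ := hperm θ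
    rw [hOmega, Crystal.charpoly_specFun, ← Equiv.prod_comp τ]
    simp only [hτ]
  · obtain ⟨τ, hτ⟩ := hperm θ
    rw [hτ, Crystal.rootFun_of_nonneg (hpos.eigenvalues_nonneg (τ k))]
    exact ⟨Complex.ofReal_im _, Real.sqrt_nonneg _⟩
  · obtain ⟨O, hOU, hO, hΘO, B, hB⟩ := Crystal.exists_analytic_frame (κ := κ) (v := v) hH
      hCs.isOpen_compl hΘ hinj hP ((hgen Θ hΘ).1.exists_perm hκ)
    refine ⟨O, hO, hΘO, fun k θ hθ => ?_, B, fun θ hθ => ⟨(hB θ hθ).1, (hB θ hθ).2.1, ?_⟩⟩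
    · refine Crystal.anAt_iff_realAnalyticAt.mp (((hgen θ (hOU hθ)).2.2 (κ k)).congr ?_)
      exact (hnhds θ (hOU hθ)).mono fun η hη => hω η hη k
    · rw [hOmega, (hB θ hθ).2.2]
      simp only [hω θ (hOU hθ)]
  · rw [hω θ hθ, hω θ hθ, Crystal.rootFun_injective.eq_iff, (hinj θ hθ).eq_iff,
      (hblock _ _).mp hk, (hblock _ _).mp hl]
  · rw [hω θ hθ, hlast2, hOmega]
    exact Crystal.range_specProj (hH θ) Crystal.rootFun_injective _
  · rw [hOmega, Crystal.specFun_eq_sum_specProj (hH θ) (hinj θ hθ) (hrange θ hθ)]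
    simp only [hω θ hθ, hlast2]
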